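/- **Conventions.** For a simplicial set $X$, $C_n(X)$ is the free abelian group on the non-degenerate $n$-simplices, and $C_*(X)$ is the normalized chain complex (alternating sum of faces, degenerate faces set to $0$); a simplicial map $\phi$ induces $\phi_*$ on it. A *discrete vector field* $V$ on a chain complex $(C_*,d)$ of free abelian groups with distinguished bases of cells is a set of pairs $(\sigma,\tau)$, $\sigma$ an $n$-cell and $\tau$ an $(n+1)$-cell, such that $\sigma$ has coefficient $\pm1$ in $d\tau$ and every cell appears in at most one pair and in only one role; the cells are thus divided into source, target and critical (unused) cells. It is *admissible* if the lengths of the $V$-paths (sequences of vectors $(\sigma_k,\tau_k)$ where $\sigma_{k+1}\ne\sigma_k$ has non-zero coefficient in $d\tau_k$) starting from a given cell are bounded. Write $t,s,c$ for the target, source and critical components of chains, $d_{ab}$ for the component of $d$ from $b$ to $a$. The *W-reduction* of an admissible $V$ is the reduction $(f,g,h):(C_*,d)\Rightarrow (C^c_*,d')$ onto the free groups on the critical cells given by $$d'=d_{cc}-d_{ct}d_{st}^{-1}d_{sc},\quad f=\pi_c-d_{ct}d_{st}^{-1}\pi_s,\quad g=\iota_c-\iota_t d_{st}^{-1}d_{sc},\quad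 h=\iota_t d_{st}^{-1}\pi_s ,$$ where *reduction* means that $f,g$ are chain maps and $fg=1$, $gf+dh+hd=1$, $fh=0$, $hg=0$, $hh=0$. A *morphism* from a reduction $(f,g,h):(A,d)\Rightarrow(B,d)$ to a reduction $(f',g',h'):(A',d)\Rightarrow(B',d)$ is a pair of chain maps $\Phi:A\to A'$, $\Psi:B\to B'$ with $\Psi f=f'\Phi$, $\Phi g=g'\Psi$, $\Phi h=h'\Phi$. **Eilenberg-Zilber vector field.** Every non-degenerate $n$-simplex of $X\times Y$ is uniquely $(\alpha^*\sigma,\beta^*\tau)$ with $\sigma\in X_p,\tau\in Y_q$ non-degenerate and $\alpha,\beta$ monotone surjections; it is coded by $(\sigma,\tau)$ and the strictly increasing path $\pi=(\alpha,\beta)$ in the lattice $[0..p]\times[0..q]$, whose steps are horizontal $(1,0)$, vertical $(0,1)$ or diagonal $(1,1)$. Call *event* a diagonal step, or a vertical step immediately followed by a horizontal one (a bend). The vectors of $V_{X\times Y}$ are the pairs of simplices $(\rho,\rho')$ with the same $(\sigma,\tau)$ such that the last event of the path of $\rho'$ is a bend and the path of $\rho$ is obtained from that of $\rho'$ by removing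 the middle vertex of this bend. **Theorem.** (1) For all simplicial sets $X,Y$, $V_{X\times Y}$ is an admissible discrete vector field on $C_*(X\times Y)$; sending $\sigma\otimes\tau$ ($\sigma\in X_p$, $\tau\in Y_q$ non-degenerate) to the simplex of path $(0,0),(1,0),\dots,(p,0),(p,1),\dots,(p,q)$ over $(\sigma,\tau)$ is an isomorphism of graded groups from $C_*(X)\otimes C_*(Y)$ to the critical chains; and the associated W-reduction, transported along this isomorphism, is a reduction $(f,g,h):C_*(X\times Y)\Rightarrow C_*(X)\otimes C_*(Y)$ (the *Eilenberg-Zilber reduction*), the graded group $C_*(X)\otimes C_*(Y)$ carrying the differential transported from the critical complex. (2) For all simplicial maps $\phi:X\to X'$ and $\psi:Y\to Y'$, the pair $\big((\phi\times\psi)_*,\ \phi_*\otimes\psi_*\big)$ is a morphism from the Eilenberg-Zilber reduction of $X\times Y$ to that of $X'\times Y'$. Moreover $\phi\times\psi$ is compatible with the vector fields: if $(\rho,\rho')\in V_{X\times Y}$ and the image of $\rho'$ is non-degenerate, then the image of $\rho$ is non-degenerate and the pair of images is in $V_{X'\times Y'}$; and the image of a critical simplex is critical if it is non-degenerate. (3)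 The induced morphism is natural: identities induce identities, and the morphism induced by $(\phi'\phi,\psi'\psi)$ is the composition of the morphisms induced by $(\phi,\psi)$ and $(\phi',\psi')$. -/

import Mathlib

open CategoryTheory Simplicial MonoidalCategory
open scoped TensorProduct DirectSum

universe u

noncomputable section

namespace EZ

/-! ## Algebraic cellular complexes, discrete vector fields, reductions -/

/-- An algebraic cellular complex (nonnegatively graded): the group of `n`-chains is the free
abelian group on the `n`-cells. -/
structure CellComplex where
  cells : ℕ → Type u
  d : ∀ n, (cells (n + 1) →₀ ℤ) →ₗ[ℤ] (cells n →₀ ℤ)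
  d_comp_d : ∀ n, d n ∘ₗ d (n + 1) = 0

namespace CellComplex

/-- The group of `n`-chains. -/
abbrev Chains (C : CellComplex.{u}) (n : ℕ) : Type u := C.cells n →₀ ℤ

/-- The incidence number: the coefficient of `σ` in `d τ`. -/
def incidence (C : CellComplex.{u}) {n : ℕ} (σ : C.cells n) (τ : C.cells (n + 1)) : ℤ :=
  C.d n (Finsupp.single τ 1) σ

/-- A collection of pairs (`n`-cell, `(n+1)`-cell). -/
abbrev Field (C : CellComplex.{u}) : Type u := ∀ n, C.cells n → C.cells (n + 1) → Prop

variable {C : CellComplex.{u}} (V : C.Field)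

/-- `σ` is the source of some vector. -/
def IsSource {n : ℕ} (σ : C.cells n) : Prop := ∃ τ, V n σ τ

/-- `τ` is the target of some vector. -/
def IsTarget {n : ℕ} (c : C.cells n) : Prop :=
  match n, c with
  | 0, _ => False
  | n + 1, τ => ∃ σ, V n σ τ

/-- A cell is critical if it appears in no vector. -/
def IsCritical {n : ℕ} (c : C.cells n) : Prop := ¬ IsSource V c ∧ ¬ IsTarget V c

/-- Discrete vector field: in every vector the source is a regular face of the target, and a cell
appears at most once. -/
structure IsVectorField : Prop where
  regular : ∀ n (σ : C.cells n) (τ : C.cells (n + 1)), V n σ τ → |C.incidence σ τ| = 1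
  target_unique : ∀ n (σ : C.cells n) (τ τ' : C.cells (n + 1)), V n σ τ → V n σ τ' → τ = τ'
  source_unique : ∀ n (σ σ' : C.cells n) (τ : C.cells (n + 1)), V n σ τ → V n σ' τ → σ = σ'
  disjoint : ∀ n (c : C.cells n), ¬ (IsSource V c ∧ IsTarget V c)

/-- `V`-paths: sequences of vectors such that each source is a face of the preceding target,
different from the preceding source. -/
def IsPath {n : ℕ} (l : List (C.cells n × C.cells (n + 1))) : Prop :=
  (∀ v ∈ l, V n v.1 v.2) ∧ l.IsChain (fun v w => C.incidence w.1 v.2 ≠ 0 ∧ w.1 ≠ v.1)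

/-- Admissibility: the lengths of the `V`-paths starting from a given cell are bounded. -/
def IsAdmissible : Prop :=
  ∀ n, ∃ bound : C.cells n → ℕ, ∀ (v : C.cells n × C.cells (n + 1)) (l : List _),
    IsPath V (v :: l) → (v :: l).length ≤ bound v.1

end CellComplex

/-- The inverse of a bijective linear map (and `0` for other linear maps). -/
def linInv {M N : Type*} [AddCommMonoid M] [Module ℤ M] [AddCommMonoid N] [Module ℤ N]
    (f : M →ₗ[ℤ] N) : N →ₗ[ℤ] M :=
  open scoped Classical in
  if h : Function.Bijective f then (LinearEquiv.ofBijective f h).symm.toLinearMap else 0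

/-- Inclusion of the chains supported by the cells satisfying `P`. -/
def incl {A : Type u} (P : A → Prop) : ({a // P a} →₀ ℤ) →ₗ[ℤ] (A →₀ ℤ) :=
  Finsupp.lmapDomain ℤ ℤ Subtype.val

/-- Projection onto the chains supported by the cells satisfying `P`. -/
def proj {A : Type u} (P : A → Prop) : (A →₀ ℤ) →ₗ[ℤ] ({a // P a} →₀ ℤ) :=
  Finsupp.lsubtypeDomain {a | P a}

namespace CellComplex

variable {C : CellComplex.{u}} (V : C.Field)

/-- The chains generated by the critical cells. -/
abbrev CritChains (n : ℕ) : Type u := {c : C.cells n // IsCritical V c} →₀ ℤ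

/-- A block of the differential. -/
def block {n : ℕ} (P : C.cells (n + 1) → Prop) (Q : C.cells n → Prop) :
    ({c // P c} →₀ ℤ) →ₗ[ℤ] ({c // Q c} →₀ ℤ) :=
  proj Q ∘ₗ C.d n ∘ₗ incl P

/-- The component of the differential from the target cells to the source cells. -/
def dTargetSource (n : ℕ) :
    ({c : C.cells (n + 1) // IsTarget V c} →₀ ℤ) →ₗ[ℤ] ({c : C.cells n // IsSource V c} →₀ ℤ) :=
  block (IsTarget V) (IsSource V)

/-- The homotopy of the W-reduction: the inverse of `dTargetSource` on the source cells,
zero on the target and critical cells. -/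
def wH (n : ℕ) : C.Chains n →ₗ[ℤ] C.Chains (n + 1) :=
  incl (IsTarget V) ∘ₗ linInv (dTargetSource V n) ∘ₗ proj (IsSource V)

/-- The projection of the W-reduction onto the critical chains. -/
def wF (n : ℕ) : C.Chains n →ₗ[ℤ] CritChains V n :=
  proj (IsCritical V) -
    block (IsTarget V) (IsCritical V) ∘ₗ linInv (dTargetSource V n) ∘ₗ proj (IsSource V)

/-- The injection of the W-reduction. -/
def wG (n : ℕ) : CritChains V n →ₗ[ℤ] C.Chains n :=
  match n with
  | 0 => incl (IsCritical V)
  | n + 1 => incl (IsCritical V) -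
      incl (IsTarget V) ∘ₗ linInv (dTargetSource V n) ∘ₗ block (IsCritical V) (IsSource V)

/-- The differential of the critical complex. -/
def wD (n : ℕ) : CritChains V (n + 1) →ₗ[ℤ] CritChains V n :=
  block (IsCritical V) (IsCritical V) -
    block (IsTarget V) (IsCritical V) ∘ₗ linInv (dTargetSource V n) ∘ₗ
      block (IsCritical V) (IsSource V)

end CellComplex

section Reductions

variable {A B A' B' : ℕ → Type*}
  [∀ n, AddCommMonoid (A n)] [∀ n, Module ℤ (A n)]
  [∀ n, AddCommMonoid (B n)] [∀ n, Module ℤ (B n)]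
  [∀ n, AddCommMonoid (A' n)] [∀ n, Module ℤ (A' n)]
  [∀ n, AddCommMonoid (B' n)] [∀ n, Module ℤ (B' n)]

/-- `(f, g, h)` is a reduction of the chain complex `(A, dA)` onto the chain complex `(B, dB)`. -/
structure IsReduction (dA : ∀ n, A (n + 1) →ₗ[ℤ] A n) (dB : ∀ n, B (n + 1) →ₗ[ℤ] B n)
    (f : ∀ n, A n →ₗ[ℤ] B n) (g : ∀ n, B n →ₗ[ℤ] A n) (h : ∀ n, A n →ₗ[ℤ] A (n + 1)) :
    Prop where
  dA_dA : ∀ n, dA n ∘ₗ dA (n + 1) = 0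
  dB_dB : ∀ n, dB n ∘ₗ dB (n + 1) = 0
  f_comm : ∀ n, f n ∘ₗ dA n = dB n ∘ₗ f (n + 1)
  g_comm : ∀ n, g n ∘ₗ dB n = dA n ∘ₗ g (n + 1)
  f_g : ∀ n, f n ∘ₗ g n = LinearMap.id
  homotopy_zero : g 0 ∘ₗ f 0 + dA 0 ∘ₗ h 0 = LinearMap.id
  homotopy_succ : ∀ n, g (n + 1) ∘ₗ f (n + 1) + dA (n + 1) ∘ₗ h (n + 1) + h n ∘ₗ dA n =
    LinearMap.id
  f_h : ∀ n, f (n + 1) ∘ₗ h n = 0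
  h_g : ∀ n, h n ∘ₗ g n = 0
  h_h : ∀ n, h (n + 1) ∘ₗ h n = 0

/-- `(Φ, Ψ)` is a morphism from the reduction `(f, g, h) : (A, dA) ⇒ (B, dB)` to the reduction
`(f', g', h') : (A', dA') ⇒ (B', dB')`: two chain maps commuting with the three components. -/
structure IsReductionMorphism
    (dA : ∀ n, A (n + 1) →ₗ[ℤ] A n) (dB : ∀ n, B (n + 1) →ₗ[ℤ] B n)
    (f : ∀ n, A n →ₗ[ℤ] B n) (g : ∀ n, B n →ₗ[ℤ] A n) (h : ∀ n, A n →ₗ[ℤ] A (n + 1))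
    (dA' : ∀ n, A' (n + 1) →ₗ[ℤ] A' n) (dB' : ∀ n, B' (n + 1) →ₗ[ℤ] B' n)
    (f' : ∀ n, A' n →ₗ[ℤ] B' n) (g' : ∀ n, B' n →ₗ[ℤ] A' n) (h' : ∀ n, A' n →ₗ[ℤ] A' (n + 1))
    (Φ : ∀ n, A n →ₗ[ℤ] A' n) (Ψ : ∀ n, B n →ₗ[ℤ] B' n) : Prop where
  big_comm : ∀ n, Φ n ∘ₗ dA n = dA' n ∘ₗ Φ (n + 1)
  small_comm : ∀ n, Ψ n ∘ₗ dB n = dB' n ∘ₗ Ψ (n + 1)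
  f_comm : ∀ n, Ψ n ∘ₗ f n = f' n ∘ₗ Φ n
  g_comm : ∀ n, Φ n ∘ₗ g n = g' n ∘ₗ Ψ n
  h_comm : ∀ n, Φ (n + 1) ∘ₗ h n = h' n ∘ₗ Φ n

end Reductions

/-! ## Normalized chains of simplicial sets -/

/-- The normalized `n`-chains of a simplicial set. -/
abbrev NChains (X : SSet.{u}) (n : ℕ) : Type u := X.nonDegenerate n →₀ ℤ

/-- The normalized chain of a simplex: the corresponding generator, or zero if the simplex is
degenerate. -/
def cell (X : SSet.{u}) {n : ℕ} (x : X _⦋n⦌) : NChains X n :=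
  open scoped Classical in
  if hx : x ∈ X.nonDegenerate n then Finsupp.single ⟨x, hx⟩ 1 else 0

/-- The differential of the normalized chain complex: the alternating sum of the faces, where
the degenerate faces are cancelled. -/
def normD (X : SSet.{u}) (n : ℕ) : NChains X (n + 1) →ₗ[ℤ] NChains X n :=
  Finsupp.linearCombination ℤ fun x => ∑ i : Fin (n + 2), (-1 : ℤ) ^ (i : ℕ) • cell X (X.δ i x.1)

lemma cell_of_degenerate (X : SSet.{u}) {n : ℕ} (x : X _⦋n⦌) (hx : x ∈ X.degenerate n) :
    cell X x = 0 := by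
  rw [cell, dif_neg]
  exact fun h => h hx

lemma normD_cell (X : SSet.{u}) (n : ℕ) (x : X _⦋n + 1⦌) :
    normD X n (cell X x) = ∑ i : Fin (n + 2), (-1 : ℤ) ^ (i : ℕ) • cell X (X.δ i x) := by
  by_cases hx : x ∈ X.nonDegenerate (n + 1)
  · simp [cell, hx, normD]
  · have hx' : x ∈ X.degenerate (n + 1) := by
      rwa [SSet.mem_degenerate_iff_notMem_nonDegenerate]
    rw [cell_of_degenerate X x hx', map_zero]
    rw [SSet.degenerate_eq_iUnion_range_σ] at hx'
    simp only [Set.mem_iUnion, Set.mem_range] at hx'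
    obtain ⟨j, y, rfl⟩ := hx'
    symm
    have key : ∀ i : Fin (n + 2), i ≠ j.castSucc → i ≠ j.succ →
        cell X (X.δ i (X.σ j y)) = 0 := by
      intro i h1 h2
      apply cell_of_degenerate
      obtain _ | n := n
      · fin_cases j; fin_cases i <;> simp at h1 h2
      · rcases lt_or_gt_of_ne h1 with h | h
        · obtain ⟨i, rfl⟩ := Fin.eq_castSucc_of_ne_last (x := i) (Fin.ne_last_of_lt h)
          obtain ⟨j, rfl⟩ := Fin.eq_succ_of_ne_zero (i := j) (by
            rintro rfl; simp at h)
          have h' : i ≤ j.castSucc := by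
            simp only [Fin.lt_def, Fin.le_def, Fin.val_castSucc, Fin.val_succ] at h ⊢; omega
          rw [SSet.δ_comp_σ_of_le_apply h']
          exact SSet.σ_mem_degenerate _ _ _
        · have h3 : j.succ < i := by
            simp only [Fin.lt_def, Fin.val_castSucc, Fin.val_succ, ne_eq, Fin.ext_iff] at h h2 ⊢
            omega
          obtain ⟨i, rfl⟩ := Fin.eq_succ_of_ne_zero (i := i) (by
            rintro rfl; simp at h3)
          obtain ⟨j, rfl⟩ := Fin.eq_castSucc_of_ne_last (x := j) (by
            rintro rfl
            simp only [Fin.lt_def, Fin.val_succ, Fin.val_last] at h3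
            omega)
          have h' : j.castSucc < i := by
            simp only [Fin.lt_def, Fin.val_castSucc, Fin.val_succ] at h3 ⊢; omega
          rw [SSet.δ_comp_σ_of_gt_apply h']
          exact SSet.σ_mem_degenerate _ _ _
    rw [← Finset.sum_subset (Finset.subset_univ {j.castSucc, j.succ})]
    · rw [Finset.sum_pair (by simp [Fin.ext_iff]), SSet.δ_comp_σ_self_apply,
        SSet.δ_comp_σ_succ_apply]
      simp [pow_succ]
    · intro i _ hi
      simp only [Finset.mem_insert, Finset.mem_singleton, not_or] at hi
      rw [key i hi.1 hi.2, smul_zero]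

lemma normD_normD (X : SSet.{u}) (n : ℕ) : normD X n ∘ₗ normD X (n + 1) = 0 := by
  refine Finsupp.lhom_ext' fun x => LinearMap.ext_ring ?_
  have hx : normD X (n + 1) (Finsupp.single x 1) = ∑ i : Fin (n + 3),
      (-1 : ℤ) ^ (i : ℕ) • cell X (X.δ i x.1) := by simp [normD]
  simp only [LinearMap.comp_apply, Finsupp.lsingle_apply, hx, map_sum, map_zsmul, normD_cell,
    Finset.smul_sum, smul_smul, LinearMap.zero_apply]
  rw [Finset.sum_comm, ← Finset.sum_product']
  let P := Fin (n + 2) × Fin (n + 3)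
  let S : Finset P := Finset.univ.filter fun ij => (ij.2 : ℕ) ≤ (ij.1 : ℕ)
  rw [Finset.univ_product_univ, ← Finset.sum_add_sum_compl S, ← eq_neg_iff_add_eq_zero,
    ← Finset.sum_neg_distrib]
  let φ : ∀ ij : P, ij ∈ S → P := fun ij hij =>
    (Fin.castLT ij.2 (lt_of_le_of_lt (Finset.mem_filter.mp hij).right (Fin.is_lt ij.1)), ij.1.succ)
  apply Finset.sum_bij φ
  · intro ij hij
    simp_rw [S, φ, Finset.compl_filter, Finset.mem_filter_univ, Fin.val_succ,
      Fin.val_castLT] at hij ⊢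
    lia
  · rintro ⟨i, j⟩ hij ⟨i', j'⟩ hij' h
    rw [Prod.mk_inj]
    exact ⟨by simpa [φ] using! congr_arg Prod.snd h,
      by simpa [φ, Fin.castSucc_castLT] using! congr_arg Fin.castSucc (congr_arg Prod.fst h)⟩
  · rintro ⟨i', j'⟩ hij'
    simp_rw [S, Finset.compl_filter, Finset.mem_filter_univ, not_le] at hij'
    refine ⟨(j'.pred <| ?_, Fin.castSucc i'), ?_, ?_⟩
    · rintro rfl
      simp only [Fin.val_zero, not_lt_zero] at hij'
    · simpa [S] using! Nat.le_sub_one_of_lt hij'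
    · simp only [φ, Fin.castLT_castSucc, Fin.succ_pred]
  · rintro ⟨i, j⟩ hij
    have hij' : j ≤ i.castSucc := by simpa [S, Fin.le_def] using hij
    have e : X.δ i (X.δ j x.1) =
        X.δ (j.castLT (lt_of_le_of_lt (Finset.mem_filter.mp hij).right i.is_lt))
          (X.δ i.succ x.1) :=
      ConcreteCategory.congr_hom (SimplicialObject.δ_comp_δ'' (X := X) hij').symm x.1
    simp only [φ, Fin.val_succ, Fin.val_castLT, ← neg_smul]
    rw [← e]
    congr 1
    ring

/-- The normalized chain complex of a simplicial set. -/
abbrev normalized (X : SSet.{u}) : CellComplex.{u} where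
  cells n := X.nonDegenerate n
  d := normD X
  d_comp_d := normD_normD X

/-- The map induced on the normalized chains by a simplicial map. -/
def normMap {X X' : SSet.{u}} (φ : X ⟶ X') (n : ℕ) : NChains X n →ₗ[ℤ] NChains X' n :=
  Finsupp.linearCombination ℤ fun x => cell X' (φ.app _ x.1)

/-! ## s-paths -/

/-- A monotone path with `n` steps in the lattice `[0..p] × [0..q]`. -/
abbrev LPath (n p q : ℕ) : Type := Fin (n + 1) →o Fin (p + 1) × Fin (q + 1)

namespace LPath

variable {n p q : ℕ}

/-- Interior s-paths: strictly increasing paths whose two projections run all the vertices. -/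
def IsInterior (π : LPath n p q) : Prop :=
  StrictMono π ∧ Function.Surjective (fun i => (π i).1) ∧ Function.Surjective (fun i => (π i).2)

/-- The `i`-th step is vertical. -/
def Vert (π : LPath n p q) (i : Fin n) : Prop :=
  (π i.castSucc).1 = (π i.succ).1 ∧ (π i.castSucc).2 < (π i.succ).2

/-- The `i`-th step is horizontal. -/
def Horiz (π : LPath n p q) (i : Fin n) : Prop :=
  (π i.castSucc).1 < (π i.succ).1 ∧ (π i.castSucc).2 = (π i.succ).2

/-- The `i`-th step is diagonal. -/
def Diag (π : LPath n p q) (i : Fin n) : Prop :=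
  (π i.castSucc).1 < (π i.succ).1 ∧ (π i.castSucc).2 < (π i.succ).2

/-- The `i`-th step is vertical and the next one is horizontal: read backward from `(p, q)`,
the path has a `+90°` bend at its vertex `i + 1`. -/
def Bend (π : LPath n p q) (i : Fin n) : Prop :=
  π.Vert i ∧ ∃ j : Fin n, (j : ℕ) = i + 1 ∧ π.Horiz j

/-- No event (diagonal step or bend) occurs after the `i`-th step; that is, an event at `i` is the
first one which is met when the path is run backward. -/
def NoEventAfter (π : LPath n p q) (i : Fin n) : Prop :=
  ∀ j : Fin n, i < j → ¬ π.Diag j ∧ ¬ π.Bend j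

/-- The pairing of s-paths: the first event of `π'` (run backward) is a bend, and `π` is the face
of `π'` where the vertex of this bend is skipped, so that the first event of `π` is the
corresponding diagonal step. -/
def Paired (π : LPath n p q) (π' : LPath (n + 1) p q) : Prop :=
  ∃ i : Fin (n + 1), π'.Bend i ∧ π'.NoEventAfter i ∧ ∀ j, π j = π' (i.succ.succAbove j)

/-- The last simplex: `((0,0), (1,0), …, (p,0), (p,1), …, (p,q))`. -/
def last (h : p + q = n) : LPath n p q where
  toFun i := (⟨min i p, by omega⟩, ⟨i - p, by omega⟩)
  monotone' i j hij := by
    have : (i : ℕ) ≤ j := hij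
    constructor <;> simp only [Fin.mk_le_mk] <;> omega

end LPath

/-! ## The Eilenberg-Zilber vector field and the Eilenberg-Zilber reduction -/

variable {X Y X' Y' X'' Y'' : SSet.{u}}

/-- The simplex of `X × Y` given by the path `π` in the prism `σ × τ`: the pair of
the degeneracies of `σ` and `τ` along the two projections of `π`. -/
def prismSimplex {n p q : ℕ} (σ : X _⦋p⦌) (τ : Y _⦋q⦌) (π : LPath n p q) : (X ⊗ Y) _⦋n⦌ :=
  (X.map (SimplexCategory.mkHom (OrderHom.fst.comp π)).op σ,
    Y.map (SimplexCategory.mkHom (OrderHom.snd.comp π)).op τ)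

/-- The Eilenberg-Zilber vector field of `X × Y`: the vectors are the pairs of simplices of a
common prism `σ × τ`, with `σ` and `τ` non-degenerate, coded by two paired interior s-paths. -/
def ezField (X Y : SSet.{u}) : (normalized (X ⊗ Y)).Field := fun n ρ ρ' =>
  ∃ (p q : ℕ) (σ : X.nonDegenerate p) (τ : Y.nonDegenerate q)
    (π : LPath n p q) (π' : LPath (n + 1) p q),
    π.IsInterior ∧ π'.IsInterior ∧ π.Paired π' ∧
      ρ.1 = prismSimplex σ.1 τ.1 π ∧ ρ'.1 = prismSimplex σ.1 τ.1 π'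

/-- The underlying graded module of the tensor product of the normalized chain complexes. -/
abbrev Tens (X Y : SSet.{u}) (n : ℕ) : Type u :=
  ⨁ pq : {pq : ℕ × ℕ // pq.1 + pq.2 = n}, NChains X pq.1.1 ⊗[ℤ] NChains Y pq.1.2

/-- The map `φ ⊗ ψ` between the tensor products. -/
def tensMap (φ : X ⟶ X') (ψ : Y ⟶ Y') (n : ℕ) : Tens X Y n →ₗ[ℤ] Tens X' Y' n :=
  DirectSum.lmap fun pq : {pq : ℕ × ℕ // pq.1 + pq.2 = n} =>
    TensorProduct.map (normMap φ pq.1.1) (normMap ψ pq.1.2)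

/-- The identification of the tensor product with the critical chains of the Eilenberg-Zilber
vector field: `σ ⊗ τ` is sent to the last simplex of the prism `σ × τ`. -/
def critOfTens (X Y : SSet.{u}) (n : ℕ) :
    Tens X Y n →ₗ[ℤ] CellComplex.CritChains (ezField X Y) n :=
  DirectSum.toModule ℤ {pq : ℕ × ℕ // pq.1 + pq.2 = n} _ fun pq =>
    Finsupp.linearCombination ℤ (fun στ : X.nonDegenerate pq.1.1 × Y.nonDegenerate pq.1.2 =>
      proj (CellComplex.IsCritical (ezField X Y))
        (cell (X ⊗ Y) (prismSimplex στ.1.1 στ.2.1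
          (LPath.last pq.2)))) ∘ₗ
      (finsuppTensorFinsupp' ℤ (X.nonDegenerate pq.1.1) (Y.nonDegenerate pq.1.2)).toLinearMap

/-- The projection of the Eilenberg-Zilber reduction. -/
def ezF (X Y : SSet.{u}) (n : ℕ) : NChains (X ⊗ Y) n →ₗ[ℤ] Tens X Y n :=
  linInv (critOfTens X Y n) ∘ₗ CellComplex.wF (ezField X Y) n

/-- The injection of the Eilenberg-Zilber reduction. -/
def ezG (X Y : SSet.{u}) (n : ℕ) : Tens X Y n →ₗ[ℤ] NChains (X ⊗ Y) n :=
  CellComplex.wG (ezField X Y) n ∘ₗ critOfTens X Y n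

/-- The homotopy of the Eilenberg-Zilber reduction. -/
def ezH (X Y : SSet.{u}) (n : ℕ) : NChains (X ⊗ Y) n →ₗ[ℤ] NChains (X ⊗ Y) (n + 1) :=
  CellComplex.wH (ezField X Y) n

/-- The differential which the Eilenberg-Zilber reduction puts on the tensor product. -/
def ezD (X Y : SSet.{u}) (n : ℕ) : Tens X Y (n + 1) →ₗ[ℤ] Tens X Y n :=
  linInv (critOfTens X Y n) ∘ₗ CellComplex.wD (ezField X Y) n ∘ₗ critOfTens X Y (n + 1)

/-- Compatibility of a product map with the Eilenberg-Zilber vector fields: a vector whose target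
has a non-degenerate image is sent to a vector, and a critical simplex with a non-degenerate image
is sent to a critical simplex. -/
structure IsFieldCompatible (φ : X ⟶ X') (ψ : Y ⟶ Y') : Prop where
  vector : ∀ (n : ℕ) (ρ : (X ⊗ Y).nonDegenerate n) (ρ' : (X ⊗ Y).nonDegenerate (n + 1)),
    ezField X Y n ρ ρ' →
      ∀ hρ' : (φ ⊗ₘ ψ).app _ ρ'.1 ∈ (X' ⊗ Y').nonDegenerate (n + 1),
        ∃ hρ : (φ ⊗ₘ ψ).app _ ρ.1 ∈ (X' ⊗ Y').nonDegenerate n,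
          ezField X' Y' n ⟨(φ ⊗ₘ ψ).app _ ρ.1, hρ⟩ ⟨(φ ⊗ₘ ψ).app _ ρ'.1, hρ'⟩
  critical : ∀ (n : ℕ) (ρ : (X ⊗ Y).nonDegenerate n),
    CellComplex.IsCritical (ezField X Y) ρ →
      ∀ hρ : (φ ⊗ₘ ψ).app _ ρ.1 ∈ (X' ⊗ Y').nonDegenerate n,
        CellComplex.IsCritical (ezField X' Y') (⟨(φ ⊗ₘ ψ).app _ ρ.1, hρ⟩ :
          (X' ⊗ Y').nonDegenerate n)

end EZ

end

/-!
Let `V` be a discrete vector field with a rank decreasing strictly along its paths. The boundary of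
a target cell is, up to sign, its source plus source cells of smaller rank plus non-source cells, so
`d_st` is triangular with invertible diagonal, hence invertible. With `h = d_st⁻¹` extended by zero,
`ϖ = 1 - dh - hd` is a projector commuting with `d`, and `f`, `g`, `d'` are compressions of it to
the critical cells. The homotopy `h` is determined by its values in the targets and by
`π_s d h = π_s`; therefore a chain map which preserves the spans of the targets and of the critical
cells commutes with `h`, and with the whole W-reduction.

In a prism `σ × τ`, the pairing of paths trades the last event: removing the middle vertex of a bend
leaves a diagonal step, and conversely. The sum over the vertices `(a, b)` of a path of `a - b`
decreases along the vector field: another face which is a source skips a vertex where `a - b` is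
larger than at the bend. Faces outside the prism lie in smaller prisms. A path without events runs
horizontally, then vertically. A simplicial map acts on a path by collapsing the two coordinates; if
the image path is still strictly increasing, no step is collapsed, so that bends remain bends, and
no diagonal step or bend appears after the last event.
-/

namespace EZ

/-! ## Discrete vector fields and their W-reductions -/

section LinInv

variable {M N : Type*} [AddCommMonoid M] [Module ℤ M] [AddCommMonoid N] [Module ℤ N]

lemma linInv_apply_apply {f : M →ₗ[ℤ] N} (hf : Function.Bijective f) (x : M) :
    linInv f (f x) = x := by
  rw [linInv, dif_pos hf]
  exact (LinearEquiv.ofBijective f hf).symm_apply_apply x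

lemma apply_linInv_apply {f : M →ₗ[ℤ] N} (hf : Function.Bijective f) (y : N) :
    f (linInv f y) = y := by
  rw [linInv, dif_pos hf]
  exact (LinearEquiv.ofBijective f hf).apply_symm_apply y

end LinInv

section InclProj

variable {A : Type u} {P Q : A → Prop}

@[simp]
lemma incl_single (a : {a // P a}) (r : ℤ) :
    incl P (Finsupp.single a r) = Finsupp.single a.1 r :=
  Finsupp.mapDomain_single

lemma proj_single_of_pos {a : A} (ha : P a) (r : ℤ) :
    proj P (Finsupp.single a r) = Finsupp.single ⟨a, ha⟩ r := by
  classical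
  ext b
  change Finsupp.single a r b.1 = _
  simp [Finsupp.single_apply, Subtype.ext_iff]

lemma proj_single_of_neg {a : A} (ha : ¬ P a) (r : ℤ) : proj P (Finsupp.single a r) = 0 := by
  ext b
  exact Finsupp.single_eq_of_ne fun hb => ha (hb ▸ b.2)

@[simp]
lemma proj_incl (x : {a // P a} →₀ ℤ) : proj P (incl P x) = x := by
  ext a
  exact Finsupp.mapDomain_apply Subtype.val_injective x a

lemma proj_incl_of_disjoint (hPQ : ∀ a, ¬ (P a ∧ Q a)) (x : {a // P a} →₀ ℤ) :
    proj Q (incl P x) = 0 := by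
  ext b
  refine Finsupp.mapDomain_of_notMem_range x b.1 ?_
  rintro ⟨a, hab⟩
  exact hPQ b.1 ⟨hab ▸ a.2, b.2⟩

lemma incl_proj_of_mem_range {x : A →₀ ℤ} (hx : x ∈ LinearMap.range (incl P)) :
    incl P (proj P x) = x := by
  obtain ⟨y, rfl⟩ := hx
  rw [proj_incl]

lemma mem_of_single_mem {S : Submodule ℤ (A →₀ ℤ)} {x : A →₀ ℤ}
    (hx : ∀ a ∈ x.support, Finsupp.single a 1 ∈ S) : x ∈ S := by
  rw [← Finsupp.sum_single x]
  refine S.sum_mem fun a ha => ?_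
  simpa using S.smul_mem (x a) (hx a ha)

end InclProj

namespace CellComplex

section Admissible

variable {C : CellComplex.{u}} {V : C.Field}

/-- The natural number `μ` decreases strictly along the `V`-paths; a rank witnesses that `V` is
admissible. -/
def IsRank (V : C.Field) (μ : ∀ n, C.cells n → ℕ) : Prop :=
  ∀ n (σ σ' : C.cells n) (τ : C.cells (n + 1)), V n σ τ → IsSource V σ' →
    C.incidence σ' τ ≠ 0 → σ' ≠ σ → μ n σ' < μ n σ

lemma IsRank.isAdmissible {μ : ∀ n, C.cells n → ℕ} (hμ : IsRank V μ) : IsAdmissible V := by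
  intro n
  refine ⟨fun σ => μ n σ + 1, fun v l => ?_⟩
  induction l generalizing v with
  | nil => simp
  | cons w l ih =>
    rintro ⟨hvec, hchain⟩
    obtain ⟨⟨hinc, hne⟩, hchain⟩ := List.isChain_cons_cons.1 hchain
    have htail := ih w ⟨fun x hx => hvec x (List.mem_cons_of_mem _ hx), hchain⟩
    have hlt := hμ n v.1 w.1 v.2 (hvec v (by simp)) ⟨w.2, hvec w (by simp)⟩ hinc hne
    simp only [List.length_cons] at htail ⊢
    omega

lemma IsAdmissible.exists_isRank (hV : IsAdmissible V) : ∃ μ, IsRank V μ := by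
  choose bound hbound using hV
  let lengths (n : ℕ) (σ : C.cells n) : Set ℕ :=
    {k | ∃ τ l, IsPath V ((σ, τ) :: l) ∧ ((σ, τ) :: l).length = k}
  have hbdd : ∀ n σ, BddAbove (lengths n σ) := by
    rintro n σ
    refine ⟨bound n σ, ?_⟩
    rintro _ ⟨τ, l, hl, rfl⟩
    exact hbound n (σ, τ) l hl
  refine ⟨fun n σ => sSup (lengths n σ), fun n σ σ' τ hστ ⟨τ', hτ'⟩ hinc hne => ?_⟩
  have hnonempty : (lengths n σ').Nonempty := ⟨1, τ', [], ⟨by simpa using hτ', by simp⟩, rfl⟩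
  obtain ⟨τ'', l, hl, hlength⟩ := Nat.sSup_mem hnonempty (hbdd n σ')
  refine Nat.lt_of_succ_le (le_csSup (hbdd n σ) ⟨τ, (σ', τ'') :: l, ⟨?_, ?_⟩, ?_⟩)
  · exact List.forall_mem_cons.2 ⟨hστ, hl.1⟩
  · exact List.isChain_cons_cons.2 ⟨⟨hinc, hne⟩, hl.2⟩
  · rw [List.length_cons, hlength]

lemma IsVectorField.incidence_mul_self (hV : IsVectorField V) {n : ℕ} {σ : C.cells n}
    {τ : C.cells (n + 1)} (hστ : V n σ τ) : C.incidence σ τ * C.incidence σ τ = 1 := by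
  rw [← abs_mul_abs_self, hV.regular n σ τ hστ, mul_one]

lemma dTargetSource_single {n : ℕ} (τ : {c : C.cells (n + 1) // IsTarget V c}) (r : ℤ)
    (σ : {c : C.cells n // IsSource V c}) :
    dTargetSource V n (Finsupp.single τ r) σ = r * C.incidence σ.1 τ.1 := by
  have hτ : incl (IsTarget V) (Finsupp.single τ r) = r • Finsupp.single τ.1 1 := by simp
  change C.d n (incl (IsTarget V) (Finsupp.single τ r)) σ.1 = _
  rw [hτ, map_zsmul]
  rfl

lemma dTargetSource_apply {n : ℕ} (x : {c : C.cells (n + 1) // IsTarget V c} →₀ ℤ)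
    (σ : {c : C.cells n // IsSource V c}) :
    dTargetSource V n x σ = ∑ τ ∈ x.support, x τ * C.incidence σ.1 τ.1 := by
  conv_lhs => rw [← Finsupp.sum_single x]
  simp only [Finsupp.sum, map_sum, Finsupp.finsetSum_apply, dTargetSource_single]

/-- Among the target cells in the support of a cycle, one whose source has maximal rank would
have an uncancelled source in the boundary. -/
lemma IsRank.injective_dTargetSource {μ : ∀ n, C.cells n → ℕ} (hμ : IsRank V μ)
    (hV : IsVectorField V) (n : ℕ) : Function.Injective (dTargetSource V n) := by
  rw [injective_iff_map_eq_zero]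
  intro x hx
  by_contra hne
  choose s hs using fun τ : {c : C.cells (n + 1) // IsTarget V c} => τ.2
  obtain ⟨τ, hτ, hmax⟩ := Finset.exists_max_image x.support (fun τ => μ n (s τ))
    (Finsupp.support_nonempty_iff.2 hne)
  have hothers : ∀ τ' ∈ x.support, τ' ≠ τ → x τ' * C.incidence (s τ) τ'.1 = 0 := by
    intro τ' hτ' hne'
    by_contra hinc
    have hsource : s τ ≠ s τ' := fun h => hne' (Subtype.ext
      (hV.target_unique n (s τ') _ _ (hs τ') (h ▸ hs τ)))
    exact (hmax τ' hτ').not_gt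
      (hμ n (s τ') (s τ) τ'.1 (hs τ') ⟨_, hs τ⟩ (right_ne_zero_of_mul hinc) hsource)
  have hcoeff : x τ * C.incidence (s τ) τ.1 = 0 := by
    rw [← Finset.sum_eq_single τ hothers fun h => absurd hτ h,
      ← dTargetSource_apply x ⟨s τ, τ.1, hs τ⟩, hx, Finsupp.zero_apply]
  rcases mul_eq_zero.1 hcoeff with h0 | h0
  · exact Finsupp.mem_support_iff.1 hτ h0
  · simpa [h0] using hV.incidence_mul_self (hs τ)

/-- Up to sign `dτ - σ` is a combination of source cells of smaller rank. -/
lemma IsRank.single_mem_range_dTargetSource {μ : ∀ n, C.cells n → ℕ} (hμ : IsRank V μ)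
    (hV : IsVectorField V) {n : ℕ} (σ : {c : C.cells n // IsSource V c}) :
    Finsupp.single σ 1 ∈ LinearMap.range (dTargetSource V n) := by
  induction hm : μ n σ.1 using Nat.strong_induction_on generalizing σ with
  | _ m ih =>
  subst hm
  obtain ⟨τ, hτ⟩ := σ.2
  set y := dTargetSource V n (Finsupp.single ⟨τ, σ.1, hτ⟩ 1) with hy
  have hy_apply (σ') : y σ' = C.incidence σ'.1 τ := by rw [hy, dTargetSource_single, one_mul]
  have hrest : y.erase σ ∈ LinearMap.range (dTargetSource V n) := by
    classical
    refine mem_of_single_mem fun σ' hσ' => ?_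
    rw [Finsupp.support_erase, Finset.mem_erase, Finsupp.mem_support_iff, hy_apply] at hσ'
    exact ih _ (hμ n σ.1 σ'.1 τ hτ σ'.2 hσ'.2 (Subtype.coe_ne_coe.2 hσ'.1)) σ' rfl
  have hσ : Finsupp.single σ (y σ) ∈ LinearMap.range (dTargetSource V n) := by
    rw [← add_sub_cancel_right (Finsupp.single σ (y σ)) (y.erase σ), Finsupp.single_add_erase]
    exact Submodule.sub_mem _ (LinearMap.mem_range_self _ _) hrest
  simpa [hy_apply, hV.incidence_mul_self hτ] using Submodule.smul_mem _ (y σ) hσ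

theorem IsAdmissible.bijective_dTargetSource (hA : IsAdmissible V) (hV : IsVectorField V) (n : ℕ) :
    Function.Bijective (dTargetSource V n) := by
  obtain ⟨μ, hμ⟩ := hA.exists_isRank
  refine ⟨hμ.injective_dTargetSource hV n, LinearMap.range_eq_top.1 (eq_top_iff.2 fun x _ => ?_)⟩
  exact mem_of_single_mem fun σ _ => hμ.single_mem_range_dTargetSource hV σ

end Admissible

section WReduction

variable {C : CellComplex.{u}} {V : C.Field}

lemma d_d (n : ℕ) (x : C.Chains (n + 2)) : C.d n (C.d (n + 1) x) = 0 :=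
  LinearMap.congr_fun (C.d_comp_d n) x

lemma IsVectorField.incl_proj_add_incl_proj_add_incl_proj (hV : IsVectorField V) {n : ℕ}
    (x : C.Chains n) :
    incl (IsTarget V) (proj (IsTarget V) x) + incl (IsSource V) (proj (IsSource V) x) +
      incl (IsCritical V) (proj (IsCritical V) x) = x := by
  induction x using Finsupp.induction_linear with
  | zero => simp only [map_zero, add_zero]
  | add x y hx hy =>
    refine Eq.trans ?_ (congrArg₂ (· + ·) hx hy)
    simp only [map_add]
    abel
  | single a r =>
    by_cases hs : IsSource V a
    · have ht : ¬ IsTarget V a := fun h => hV.disjoint n a ⟨hs, h⟩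
      have hc : ¬ IsCritical V a := fun h => h.1 hs
      simp [proj_single_of_pos hs, proj_single_of_neg ht, proj_single_of_neg hc]
    · by_cases ht : IsTarget V a
      · have hc : ¬ IsCritical V a := fun h => h.2 ht
        simp [proj_single_of_neg hs, proj_single_of_pos ht, proj_single_of_neg hc]
      · have hc : IsCritical V a := ⟨hs, ht⟩
        simp [proj_single_of_neg hs, proj_single_of_neg ht, proj_single_of_pos hc]

/-- The projector `1 - dh - hd = gf` of the W-reduction; all the components of the reduction are
compressions of it, which turns the identities of a reduction into identities of projectors. -/
noncomputable def wProj (V : C.Field) (n : ℕ) : C.Chains n →ₗ[ℤ] C.Chains n :=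
  match n with
  | 0 => LinearMap.id - C.d 0 ∘ₗ wH V 0
  | n + 1 => LinearMap.id - C.d (n + 1) ∘ₗ wH V (n + 1) - wH V n ∘ₗ C.d n

lemma wH_incl_critical {n : ℕ} (x : CritChains V n) : wH V n (incl (IsCritical V) x) = 0 := by
  simp [wH, proj_incl_of_disjoint fun a (h : IsCritical V a ∧ IsSource V a) => h.1.1 h.2]

lemma proj_critical_wH {n : ℕ} (x : C.Chains n) : proj (IsCritical V) (wH V n x) = 0 :=
  proj_incl_of_disjoint (fun _ h => h.2.2 h.1) _

lemma wH_incl_target (hV : IsVectorField V) {n : ℕ} (x : {c : C.cells n // IsTarget V c} →₀ ℤ) :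
    wH V n (incl (IsTarget V) x) = 0 := by
  simp [wH, proj_incl_of_disjoint fun a h => hV.disjoint n a h.symm]

lemma proj_source_wH (hV : IsVectorField V) {n : ℕ} (x : C.Chains n) :
    proj (IsSource V) (wH V n x) = 0 :=
  proj_incl_of_disjoint (fun a h => hV.disjoint (n + 1) a h.symm) _

lemma wH_wH (hV : IsVectorField V) {n : ℕ} (x : C.Chains n) : wH V (n + 1) (wH V n x) = 0 :=
  wH_incl_target hV _

lemma wF_apply {n : ℕ} (x : C.Chains n) : wF V n x = proj (IsCritical V) (wProj V n x) := by
  have hF : wF V n x = proj (IsCritical V) x - proj (IsCritical V) (C.d n (wH V n x)) := rfl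
  cases n <;> simp [hF, wProj, proj_critical_wH]

lemma wG_apply {n : ℕ} (x : CritChains V n) : wG V n x = wProj V n (incl (IsCritical V) x) := by
  cases n with
  | zero => simp [wG, wProj, wH_incl_critical]
  | succ n =>
    have hG : wG V (n + 1) x =
      incl (IsCritical V) x - wH V n (C.d n (incl (IsCritical V) x)) := rfl
    simp [hG, wProj, wH_incl_critical]

lemma wD_apply {n : ℕ} (x : CritChains V (n + 1)) :
    wD V n x = proj (IsCritical V) (C.d n (wProj V (n + 1) (incl (IsCritical V) x))) := by
  have hD : wD V n x = proj (IsCritical V) (C.d n (incl (IsCritical V) x)) -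
    proj (IsCritical V) (C.d n (wH V n (C.d n (incl (IsCritical V) x)))) := rfl
  simp [hD, wProj, wH_incl_critical]

lemma wProj_d {n : ℕ} (x : C.Chains (n + 1)) :
    wProj V n (C.d n x) = C.d n (wProj V (n + 1) x) := by
  cases n <;> simp [wProj, d_d]

variable (hV : IsVectorField V) (hB : ∀ n, Function.Bijective (dTargetSource V n))

include hB in
lemma proj_source_d_wH {n : ℕ} (x : C.Chains n) :
    proj (IsSource V) (C.d n (wH V n x)) = proj (IsSource V) x :=
  apply_linInv_apply (hB n) _

include hB in
lemma wH_d_incl_target {n : ℕ} (x : {c : C.cells (n + 1) // IsTarget V c} →₀ ℤ) :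
    wH V n (C.d n (incl (IsTarget V) x)) = incl (IsTarget V) x :=
  congrArg (incl (IsTarget V)) (linInv_apply_apply (hB n) x)

include hB in
lemma wH_d_wH {n : ℕ} (x : C.Chains n) : wH V n (C.d n (wH V n x)) = wH V n x :=
  wH_d_incl_target hB _

include hV hB

lemma wProj_incl_target {n : ℕ} (x : {c : C.cells n // IsTarget V c} →₀ ℤ) :
    wProj V n (incl (IsTarget V) x) = 0 := by
  cases n with
  | zero =>
    have hx : x = 0 := Finsupp.ext fun c => c.2.elim
    simp [hx]
  | succ n => simp [wProj, wH_incl_target hV, wH_d_incl_target hB]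

lemma proj_source_wProj {n : ℕ} (x : C.Chains n) : proj (IsSource V) (wProj V n x) = 0 := by
  cases n <;> simp [wProj, proj_source_d_wH hB, proj_source_wH hV]

lemma wProj_wH {n : ℕ} (x : C.Chains n) : wProj V (n + 1) (wH V n x) = 0 :=
  wProj_incl_target hV hB _

lemma wH_wProj {n : ℕ} (x : C.Chains n) : wH V n (wProj V n x) = 0 := by
  cases n <;> simp [wProj, wH_wH hV, wH_d_wH hB]

lemma wProj_wProj {n : ℕ} (x : C.Chains n) : wProj V n (wProj V n x) = wProj V n x := by
  cases n with
  | zero =>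
    nth_rw 1 [wProj]
    simp [wH_wProj hV hB]
  | succ n =>
    nth_rw 1 [wProj]
    simp [wH_wProj hV hB, ← wProj_d]

lemma wProj_incl_proj_wProj {n : ℕ} (x : C.Chains n) :
    wProj V n (incl (IsCritical V) (proj (IsCritical V) (wProj V n x))) = wProj V n x := by
  conv_rhs => rw [← wProj_wProj hV hB, ← hV.incl_proj_add_incl_proj_add_incl_proj (wProj V n x)]
  simp [wProj_incl_target hV hB, proj_source_wProj hV hB]

theorem isReduction_w : IsReduction C.d (wD V) (wF V) (wG V) (wH V) where
  dA_dA := C.d_comp_d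
  dB_dB n := LinearMap.ext fun x => by
    simp only [LinearMap.comp_apply, wD_apply, LinearMap.zero_apply, ← wProj_d,
      wProj_incl_proj_wProj hV hB, d_d, map_zero]
  f_comm n := LinearMap.ext fun x => by
    simp only [LinearMap.comp_apply, wD_apply, wF_apply, wProj_d, wProj_incl_proj_wProj hV hB]
  g_comm n := LinearMap.ext fun x => by
    simp only [LinearMap.comp_apply, wD_apply, wG_apply, ← wProj_d, wProj_incl_proj_wProj hV hB]
  f_g n := LinearMap.ext fun x => by
    simp only [LinearMap.comp_apply, wF_apply, wG_apply, wProj_wProj hV hB, LinearMap.id_apply]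
    cases n <;> simp [wProj, wH_incl_critical, proj_critical_wH]
  homotopy_zero := LinearMap.ext fun x => by
    simp only [LinearMap.comp_apply, wF_apply, wG_apply, LinearMap.add_apply,
      wProj_incl_proj_wProj hV hB]
    simp [wProj]
  homotopy_succ n := LinearMap.ext fun x => by
    simp only [LinearMap.comp_apply, wF_apply, wG_apply, LinearMap.add_apply,
      wProj_incl_proj_wProj hV hB]
    simp only [wProj, LinearMap.sub_apply, LinearMap.id_apply, LinearMap.comp_apply]
    abel
  f_h n := LinearMap.ext fun x => by simp [wF_apply, wProj_wH hV hB]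
  h_g n := LinearMap.ext fun x => by simp [wG_apply, wH_wProj hV hB]
  h_h n := LinearMap.ext fun x => by simp [wH_wH hV]

end WReduction

section Morphism

variable {C C' : CellComplex.{u}} {V : C.Field} {V' : C'.Field}

/-- A morphism of complexes with vector fields: a chain map sending chains of target cells to
chains of target cells and chains of critical cells to chains of critical cells. Nothing is
required of the source cells. -/
structure IsVectorFieldMap (V : C.Field) (V' : C'.Field)
    (Φ : ∀ n, C.Chains n →ₗ[ℤ] C'.Chains n) : Prop where
  comm : ∀ n x, Φ n (C.d n x) = C'.d n (Φ (n + 1) x)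
  target : ∀ n x, Φ n (incl (IsTarget V) x) ∈ LinearMap.range (incl (IsTarget V'))
  critical : ∀ n x, Φ n (incl (IsCritical V) x) ∈ LinearMap.range (incl (IsCritical V'))

namespace IsVectorFieldMap

variable {Φ : ∀ n, C.Chains n →ₗ[ℤ] C'.Chains n} (hΦ : IsVectorFieldMap V V' Φ)
  (hV : IsVectorField V) (hB : ∀ n, Function.Bijective (dTargetSource V n))
  (hV' : IsVectorField V') (hB' : ∀ n, Function.Bijective (dTargetSource V' n))
include hΦ hV hV'

lemma wH_map {n : ℕ} (x : C.Chains n) :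
    wH V' n (Φ n x) = wH V' n (Φ n (incl (IsSource V) (proj (IsSource V) x))) := by
  obtain ⟨t, ht⟩ := hΦ.target n (proj (IsTarget V) x)
  obtain ⟨c, hc⟩ := hΦ.critical n (proj (IsCritical V) x)
  conv_lhs => rw [← hV.incl_proj_add_incl_proj_add_incl_proj x]
  simp [← ht, ← hc, wH_incl_target hV', wH_incl_critical]

include hB hB'

/-- The chain `hx` is the target chain whose boundary has the same source component as `x`, and
the source component is all that `h` sees. -/
lemma map_wH {n : ℕ} (x : C.Chains n) : Φ (n + 1) (wH V n x) = wH V' n (Φ n x) := by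
  obtain ⟨t, ht⟩ := hΦ.target (n + 1) (linInv (dTargetSource V n) (proj (IsSource V) x))
  calc Φ (n + 1) (wH V n x)
      = wH V' n (C'.d n (Φ (n + 1) (wH V n x))) :=
        ht.symm.trans ((wH_d_incl_target hB' t).symm.trans (by rw [ht]; rfl))
    _ = wH V' n (Φ n (incl (IsSource V) (proj (IsSource V) (C.d n (wH V n x))))) := by
        rw [← hΦ.comm, hΦ.wH_map hV hV']
    _ = wH V' n (Φ n x) := by rw [proj_source_d_wH hB, ← hΦ.wH_map hV hV']

lemma map_wProj {n : ℕ} (x : C.Chains n) : Φ n (wProj V n x) = wProj V' n (Φ n x) := by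
  cases n <;> simp [wProj, hΦ.comm, hΦ.map_wH hV hB hV' hB']

omit hV' hB' in
lemma proj_critical_map_incl_proj_wProj {n : ℕ} (x : C.Chains n) :
    proj (IsCritical V') (Φ n (incl (IsCritical V) (proj (IsCritical V) (wProj V n x)))) =
      proj (IsCritical V') (Φ n (wProj V n x)) := by
  obtain ⟨t, ht⟩ := hΦ.target n (proj (IsTarget V) (wProj V n x))
  conv_rhs => rw [← hV.incl_proj_add_incl_proj_add_incl_proj (wProj V n x)]
  rw [proj_source_wProj hV hB, map_zero, add_zero, map_add, map_add, ← ht,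
    proj_incl_of_disjoint fun a h => h.2.2 h.1, zero_add]

theorem isReductionMorphism : IsReductionMorphism C.d (wD V) (wF V) (wG V) (wH V)
    C'.d (wD V') (wF V') (wG V') (wH V') Φ
    (fun n => proj (IsCritical V') ∘ₗ Φ n ∘ₗ incl (IsCritical V)) where
  big_comm n := LinearMap.ext (hΦ.comm n)
  small_comm n := LinearMap.ext fun x => by
    simp only [LinearMap.comp_apply, wD_apply]
    rw [incl_proj_of_mem_range (hΦ.critical _ x), ← wProj_d,
      hΦ.proj_critical_map_incl_proj_wProj hV hB, wProj_d, hΦ.comm, hΦ.map_wProj hV hB hV' hB']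
  f_comm n := LinearMap.ext fun x => by
    simp only [LinearMap.comp_apply, wF_apply, hΦ.proj_critical_map_incl_proj_wProj hV hB,
      hΦ.map_wProj hV hB hV' hB']
  g_comm n := LinearMap.ext fun x => by
    simp only [LinearMap.comp_apply, wG_apply, hΦ.map_wProj hV hB hV' hB',
      incl_proj_of_mem_range (hΦ.critical _ x)]
  h_comm n := LinearMap.ext fun x => hΦ.map_wH hV hB hV' hB' x

end IsVectorFieldMap

end Morphism

end CellComplex

section Transport

variable {A B A' B' K K' : ℕ → Type*}
  [∀ n, AddCommMonoid (A n)] [∀ n, Module ℤ (A n)]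
  [∀ n, AddCommMonoid (B n)] [∀ n, Module ℤ (B n)]
  [∀ n, AddCommMonoid (A' n)] [∀ n, Module ℤ (A' n)]
  [∀ n, AddCommMonoid (B' n)] [∀ n, Module ℤ (B' n)]
  [∀ n, AddCommMonoid (K n)] [∀ n, Module ℤ (K n)]
  [∀ n, AddCommMonoid (K' n)] [∀ n, Module ℤ (K' n)]
  {dA : ∀ n, A (n + 1) →ₗ[ℤ] A n} {dB : ∀ n, B (n + 1) →ₗ[ℤ] B n}
  {f : ∀ n, A n →ₗ[ℤ] B n} {g : ∀ n, B n →ₗ[ℤ] A n} {h : ∀ n, A n →ₗ[ℤ] A (n + 1)}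
  {dA' : ∀ n, A' (n + 1) →ₗ[ℤ] A' n} {dB' : ∀ n, B' (n + 1) →ₗ[ℤ] B' n}
  {f' : ∀ n, A' n →ₗ[ℤ] B' n} {g' : ∀ n, B' n →ₗ[ℤ] A' n} {h' : ∀ n, A' n →ₗ[ℤ] A' (n + 1)}
  {Φ : ∀ n, A n →ₗ[ℤ] A' n} {Ψ : ∀ n, B n →ₗ[ℤ] B' n}
  {e : ∀ n, K n →ₗ[ℤ] B n} {e' : ∀ n, K' n →ₗ[ℤ] B' n}

lemma IsReduction.transport (H : IsReduction dA dB f g h) (he : ∀ n, Function.Bijective (e n)) :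
    IsReduction dA (fun n => linInv (e n) ∘ₗ dB n ∘ₗ e (n + 1)) (fun n => linInv (e n) ∘ₗ f n)
      (fun n => g n ∘ₗ e n) h where
  dA_dA := H.dA_dA
  dB_dB n := LinearMap.ext fun x => by
    have hdd : dB n (dB (n + 1) (e (n + 2) x)) = 0 := LinearMap.congr_fun (H.dB_dB n) _
    simp [apply_linInv_apply (he _), hdd]
  f_comm n := LinearMap.ext fun x => by
    simpa [apply_linInv_apply (he _)] using
      congrArg (linInv (e n)) (LinearMap.congr_fun (H.f_comm n) x)
  g_comm n := LinearMap.ext fun x => by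
    simpa [apply_linInv_apply (he _)] using LinearMap.congr_fun (H.g_comm n) (e (n + 1) x)
  f_g n := LinearMap.ext fun x => by
    have hfg : f n (g n (e n x)) = e n x := LinearMap.congr_fun (H.f_g n) _
    simp [hfg, linInv_apply_apply (he n)]
  homotopy_zero := LinearMap.ext fun x => by
    simpa [apply_linInv_apply (he _)] using LinearMap.congr_fun H.homotopy_zero x
  homotopy_succ n := LinearMap.ext fun x => by
    simpa [apply_linInv_apply (he _)] using LinearMap.congr_fun (H.homotopy_succ n) x
  f_h n := by rw [LinearMap.comp_assoc, H.f_h, LinearMap.comp_zero]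
  h_g n := by rw [← LinearMap.comp_assoc, H.h_g, LinearMap.zero_comp]
  h_h := H.h_h

lemma IsReductionMorphism.transport
    (H : IsReductionMorphism dA dB f g h dA' dB' f' g' h' Φ Ψ)
    (he : ∀ n, Function.Bijective (e n)) (he' : ∀ n, Function.Bijective (e' n))
    {Θ : ∀ n, K n →ₗ[ℤ] K' n} (hΘ : ∀ n x, e' n (Θ n x) = Ψ n (e n x)) :
    IsReductionMorphism
      dA (fun n => linInv (e n) ∘ₗ dB n ∘ₗ e (n + 1)) (fun n => linInv (e n) ∘ₗ f n)
        (fun n => g n ∘ₗ e n) h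
      dA' (fun n => linInv (e' n) ∘ₗ dB' n ∘ₗ e' (n + 1)) (fun n => linInv (e' n) ∘ₗ f' n)
        (fun n => g' n ∘ₗ e' n) h' Φ Θ where
  big_comm := H.big_comm
  small_comm n := LinearMap.ext fun x => (he' n).1 <| by
    simpa [apply_linInv_apply (he _), apply_linInv_apply (he' _), hΘ] using
      LinearMap.congr_fun (H.small_comm n) (e (n + 1) x)
  f_comm n := LinearMap.ext fun x => (he' n).1 <| by
    simpa [apply_linInv_apply (he _), apply_linInv_apply (he' _), hΘ] using
      LinearMap.congr_fun (H.f_comm n) x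
  g_comm n := LinearMap.ext fun x => by
    simpa [hΘ] using LinearMap.congr_fun (H.g_comm n) (e n x)
  h_comm := H.h_comm

end Transport

/-! ## Events of lattice paths -/

namespace LPath

section Steps

variable {n p q : ℕ} {π : LPath n p q} {i j : Fin n}

lemma vert_or_horiz_or_diag (hπ : StrictMono π) (i : Fin n) : π.Vert i ∨ π.Horiz i ∨ π.Diag i := by
  have hlt := hπ (Fin.castSucc_lt_succ (i := i))
  rcases hlt.le.1.eq_or_lt with hfst | hfst <;> rcases hlt.le.2.eq_or_lt with hsnd | hsnd
  · exact absurd (Prod.ext hfst hsnd) hlt.ne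
  · exact Or.inl ⟨hfst, hsnd⟩
  · exact Or.inr (Or.inl ⟨hfst, hsnd⟩)
  · exact Or.inr (Or.inr ⟨hfst, hsnd⟩)

lemma vert_of_fst_eq (hπ : StrictMono π) (h : (π i.castSucc).1 = (π i.succ).1) : π.Vert i := by
  rcases vert_or_horiz_or_diag hπ i with hv | hh | hd
  exacts [hv, absurd h hh.1.ne, absurd h hd.1.ne]

lemma horiz_of_snd_eq (hπ : StrictMono π) (h : (π i.castSucc).2 = (π i.succ).2) : π.Horiz i := by
  rcases vert_or_horiz_or_diag hπ i with hv | hh | hd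
  exacts [absurd h hv.2.ne, hh, absurd h hd.2.ne]

lemma Vert.not_horiz (hi : π.Vert i) : ¬ π.Horiz i := fun h => hi.2.ne h.2

lemma Vert.not_diag (hi : π.Vert i) : ¬ π.Diag i := fun h => h.1.ne hi.1

lemma Horiz.not_diag (hi : π.Horiz i) : ¬ π.Diag i := fun h => h.2.ne hi.2

lemma bend_castSucc_iff {π : LPath (n + 1) p q} {k : Fin n} :
    π.Bend k.castSucc ↔ π.Vert k.castSucc ∧ π.Horiz k.succ := by
  refine and_congr_right fun _ => ⟨?_, fun h => ⟨k.succ, by simp, h⟩⟩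
  rintro ⟨j, hj, h⟩
  rwa [← Fin.ext (a := j) (b := k.succ) (by simpa using hj)]

lemma Bend.exists_eq_castSucc {π : LPath (n + 1) p q} {i : Fin (n + 1)} (hi : π.Bend i) :
    ∃ k : Fin n, i = k.castSucc := by
  obtain ⟨-, j, hj, -⟩ := hi
  exact ⟨⟨i, by omega⟩, rfl⟩

end Steps

section Events

variable {n p q : ℕ} {π : LPath n p q}

/-- The path contains neither a diagonal step nor a bend: these paths code the critical
simplices. -/
def IsEventFree (π : LPath n p q) : Prop := ∀ i, ¬ π.Diag i ∧ ¬ π.Bend i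

/-- The last event of the path is a diagonal step: these paths code the source simplices. -/
def EndsWithDiag (π : LPath n p q) : Prop := ∃ i, π.Diag i ∧ π.NoEventAfter i

/-- The last event of the path is a bend: these paths code the target simplices. -/
def EndsWithBend (π : LPath n p q) : Prop := ∃ i, π.Bend i ∧ π.NoEventAfter i

lemma eq_of_noEventAfter {i j : Fin n} (hi : π.Diag i ∨ π.Bend i) (hj : π.Diag j ∨ π.Bend j)
    (hi' : π.NoEventAfter i) (hj' : π.NoEventAfter j) : i = j := by
  rcases lt_trichotomy i j with h | h | h
  · exact absurd hj (not_or.2 (hi' j h))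
  · exact h
  · exact absurd hi (not_or.2 (hj' i h))

lemma EndsWithDiag.not_endsWithBend (hπ : π.EndsWithDiag) : ¬ π.EndsWithBend := by
  obtain ⟨i, hi, hi'⟩ := hπ
  rintro ⟨j, hj, hj'⟩
  obtain rfl := eq_of_noEventAfter (Or.inl hi) (Or.inr hj) hi' hj'
  exact hj.1.not_diag hi

lemma isEventFree_iff : π.IsEventFree ↔ ¬ π.EndsWithDiag ∧ ¬ π.EndsWithBend := by
  refine ⟨fun h => ⟨fun ⟨i, hi, _⟩ => (h i).1 hi, fun ⟨i, hi, _⟩ => (h i).2 hi⟩, fun h => ?_⟩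
  by_contra hevent
  have hnonempty : {i | π.Diag i ∨ π.Bend i}.Nonempty := by
    simpa [IsEventFree, Set.Nonempty, imp_iff_not_or, not_and_or] using hevent
  obtain ⟨i, hi, hmax⟩ := (Set.toFinite _).exists_maximal hnonempty
  have hlast : π.NoEventAfter i := fun j hij => not_or.1 fun hj => hij.not_ge (hmax hj hij.le)
  exact hi.elim (fun hd => h.1 ⟨i, hd, hlast⟩) fun hb => h.2 ⟨i, hb, hlast⟩

lemma snd_eq_of_horiz (hπ : StrictMono π) {a : Fin (n + 1)}
    (ha : ∀ i : Fin n, a ≤ i.castSucc → ¬ π.Diag i ∧ ¬ π.Bend i) {j : Fin n}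
    (haj : a ≤ j.castSucc) (hj : π.Horiz j) : (π j.succ).2 = (π a).2 := by
  obtain _ | n := n
  · exact j.elim0
  induction j using Fin.induction with
  | zero => rw [← hj.2, Fin.le_zero_iff.1 haj, Fin.castSucc_zero]
  | succ j ih =>
    rw [← hj.2]
    rcases haj.eq_or_lt with rfl | hlt
    · rfl
    · have haj' : a ≤ j.castSucc.castSucc := by
        rw [Fin.lt_def, Fin.val_castSucc, Fin.val_succ] at hlt
        rw [Fin.le_def, Fin.val_castSucc, Fin.val_castSucc]
        omega
      refine ih haj' ?_
      rcases vert_or_horiz_or_diag hπ j.castSucc with hv | hh | hd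
      · exact absurd (bend_castSucc_iff.2 ⟨hv, hj⟩) (ha _ haj').2
      · exact hh
      · exact absurd hd (ha _ haj').1

lemma IsEventFree.fst_eq_of_vert (hfree : π.IsEventFree) (hπ : StrictMono π) {j : Fin n}
    (hj : π.Vert j) {m : Fin (n + 1)} (hm : j.castSucc ≤ m) : (π m).1 = (π j.castSucc).1 := by
  induction m using Fin.induction with
  | zero => rw [Fin.le_zero_iff.1 hm]
  | succ i ih =>
    rcases hm.eq_or_lt with h | h
    · rw [h]
    · have hji : j.castSucc ≤ i.castSucc := Fin.le_castSucc_iff.2 h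
      rw [← ih hji]
      rcases vert_or_horiz_or_diag hπ i with hv | hh | hd
      · exact hv.1.symm
      · have hsnd := snd_eq_of_horiz hπ (fun i _ => hfree i) hji hh
        exact absurd ((π.monotone (Fin.succ_le_succ_iff.2 hji)).2.trans hsnd.le) hj.2.not_ge
      · exact absurd hd (hfree i).1

end Events

section Interior

variable {n p q : ℕ}

lemma map_zero_of_surjective {f : Fin (n + 1) →o Fin (p + 1)} (hf : Function.Surjective f) :
    f 0 = 0 := by
  obtain ⟨a, ha⟩ := hf 0
  exact Fin.le_zero_iff.1 (ha ▸ f.monotone (Fin.zero_le a))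

lemma map_last_of_surjective {f : Fin (n + 1) →o Fin (p + 1)} (hf : Function.Surjective f) :
    f (Fin.last n) = Fin.last p := by
  obtain ⟨a, ha⟩ := hf (Fin.last p)
  exact Fin.last_le_iff.1 (ha ▸ f.monotone (Fin.le_last a))

lemma map_succ_le_of_surjective {f : Fin (n + 1) →o Fin (p + 1)} (hf : Function.Surjective f)
    (i : Fin n) : (f i.succ : ℕ) ≤ f i.castSucc + 1 := by
  by_contra! hlt
  obtain ⟨a, ha⟩ := hf ⟨f i.castSucc + 1, by omega⟩
  replace ha : (f a : ℕ) = f i.castSucc + 1 := congrArg Fin.val ha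
  rcases le_or_gt a i.castSucc with h | h
  · have hle := Fin.le_def.1 (f.monotone h)
    omega
  · have hle := Fin.le_def.1 (f.monotone (Fin.castSucc_lt_iff_succ_le.1 h))
    omega

lemma IsInterior.le_left {π : LPath n p q} (hπ : π.IsInterior) : p ≤ n := by
  simpa using Fintype.card_le_of_surjective _ hπ.2.1

lemma IsInterior.le_right {π : LPath n p q} (hπ : π.IsInterior) : q ≤ n := by
  simpa using Fintype.card_le_of_surjective _ hπ.2.2

lemma IsInterior.fst_add_snd {π : LPath n p q} (hπ : π.IsInterior) (hdiag : ∀ i, ¬ π.Diag i)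
    (m : Fin (n + 1)) : ((π m).1 + (π m).2 : ℕ) = m := by
  have hfst (i : Fin n) : ((π i.succ).1 : ℕ) ≤ (π i.castSucc).1 + 1 :=
    map_succ_le_of_surjective (f := OrderHom.fst.comp π) hπ.2.1 i
  have hsnd (i : Fin n) : ((π i.succ).2 : ℕ) ≤ (π i.castSucc).2 + 1 :=
    map_succ_le_of_surjective (f := OrderHom.snd.comp π) hπ.2.2 i
  induction m using Fin.induction with
  | zero =>
    have hfst0 : (π 0).1 = 0 := map_zero_of_surjective (f := OrderHom.fst.comp π) hπ.2.1
    have hsnd0 : (π 0).2 = 0 := map_zero_of_surjective (f := OrderHom.snd.comp π) hπ.2.2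
    simp [hfst0, hsnd0]
  | succ i ih =>
    specialize hfst i
    specialize hsnd i
    rw [Fin.val_castSucc] at ih
    rw [Fin.val_succ]
    rcases vert_or_horiz_or_diag hπ.1 i with hv | hh | hd
    · have h1 := congrArg Fin.val hv.1
      have h2 := Fin.lt_def.1 hv.2
      omega
    · have h1 := congrArg Fin.val hh.2
      have h2 := Fin.lt_def.1 hh.1
      omega
    · exact absurd hd (hdiag i)

lemma IsInterior.add_eq {π : LPath n p q} (hπ : π.IsInterior) (hdiag : ∀ i, ¬ π.Diag i) :
    p + q = n := by
  have hfst : (π (Fin.last n)).1 = Fin.last p :=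
    map_last_of_surjective (f := OrderHom.fst.comp π) hπ.2.1
  have hsnd : (π (Fin.last n)).2 = Fin.last q :=
    map_last_of_surjective (f := OrderHom.snd.comp π) hπ.2.2
  simpa [hfst, hsnd] using hπ.fst_add_snd hdiag (Fin.last n)

lemma IsInterior.snd_eq_zero_or_fst_eq_last {π : LPath n p q} (hπ : π.IsInterior)
    (hfree : π.IsEventFree) (m : Fin (n + 1)) : (π m).2 = 0 ∨ (π m).1 = Fin.last p := by
  have hsnd0 : (π 0).2 = 0 := map_zero_of_surjective (f := OrderHom.snd.comp π) hπ.2.2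
  have hfst : (π (Fin.last n)).1 = Fin.last p :=
    map_last_of_surjective (f := OrderHom.fst.comp π) hπ.2.1
  obtain rfl | ⟨j, rfl⟩ := Fin.eq_zero_or_eq_succ m
  · exact Or.inl hsnd0
  rcases vert_or_horiz_or_diag hπ.1 j with hv | hh | hd
  · refine Or.inr ?_
    rw [← hv.1, ← hfree.fst_eq_of_vert hπ.1 hv (Fin.le_last _), hfst]
  · refine Or.inl ?_
    rw [snd_eq_of_horiz hπ.1 (fun i _ => hfree i) (Fin.zero_le _) hh, hsnd0]
  · exact absurd hd (hfree j).1

lemma fst_last_apply (h : p + q = n) (i : Fin (n + 1)) : ((last h i).1 : ℕ) = min (i : ℕ) p := rfl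

lemma snd_last_apply (h : p + q = n) (i : Fin (n + 1)) : ((last h i).2 : ℕ) = i - p := rfl

lemma IsInterior.eq_last {π : LPath n p q} (hπ : π.IsInterior) (hfree : π.IsEventFree)
    (h : p + q = n) : π = last h := by
  refine OrderHom.ext _ _ (funext fun m => ?_)
  have hsum := hπ.fst_add_snd (fun i => (hfree i).1) m
  have hcase := hπ.snd_eq_zero_or_fst_eq_last hfree m
  have := (π m).1.is_le
  simp only [Fin.ext_iff, Fin.val_zero, Fin.val_last] at hcase
  refine Prod.ext (Fin.ext ?_) (Fin.ext ?_)
  · rw [fst_last_apply]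
    omega
  · rw [snd_last_apply]
    omega

lemma isInterior_last (h : p + q = n) : (last h).IsInterior := by
  refine ⟨(last h).monotone.strictMono_of_injective fun i j hij => ?_, fun a => ?_, fun b => ?_⟩
  · have hfst := congrArg (fun v => (v.1 : ℕ)) hij
    have hsnd := congrArg (fun v => (v.2 : ℕ)) hij
    simp only [fst_last_apply, snd_last_apply] at hfst hsnd
    omega
  · exact ⟨⟨a, by omega⟩, Fin.ext (min_eq_left a.is_le)⟩
  · exact ⟨⟨p + b, by omega⟩, Fin.ext (Nat.add_sub_cancel_left p b)⟩

lemma isEventFree_last (h : p + q = n) : (last h).IsEventFree := by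
  refine fun i => ⟨fun ⟨hfst, hsnd⟩ => ?_, fun ⟨⟨_, hsnd⟩, j, hj, ⟨hfst, _⟩⟩ => ?_⟩ <;>
  · rw [Fin.lt_def] at hfst hsnd
    simp only [fst_last_apply, snd_last_apply, Fin.val_castSucc, Fin.val_succ] at hfst hsnd
    omega

end Interior

section Face

variable {n p q : ℕ}

/-- The path obtained by removing the vertex `v`. -/
def face (π : LPath (n + 1) p q) (v : Fin (n + 2)) : LPath n p q :=
  π.comp (Fin.succAboveOrderEmb v).toOrderHom

lemma face_apply (π : LPath (n + 1) p q) (v : Fin (n + 2)) (i : Fin (n + 1)) :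
    π.face v i = π (v.succAbove i) := rfl

lemma face_injective {π : LPath (n + 1) p q} (hπ : Function.Injective π) :
    Function.Injective π.face := fun _ _ h =>
  Fin.succAbove_left_injective (funext fun i => hπ (DFunLike.congr_fun h i))

variable {π : LPath (n + 1) p q} {v : Fin (n + 2)} {j : Fin n}

lemma face_castSucc (hj : v ≤ j.castSucc.castSucc) : π.face v j.castSucc = π j.succ.castSucc := by
  rw [face_apply, Fin.succAbove_of_le_castSucc _ _ hj, Fin.succ_castSucc]

lemma face_succ (hj : v ≤ j.castSucc.castSucc) : π.face v j.succ = π j.succ.succ := by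
  rw [face_apply, Fin.succAbove_of_le_castSucc _ _
    (hj.trans (Fin.castSucc_le_castSucc_iff.2 (Fin.castSucc_le_succ j)))]

lemma vert_face_iff (hj : v ≤ j.castSucc.castSucc) : (π.face v).Vert j ↔ π.Vert j.succ := by
  rw [Vert, Vert, face_castSucc hj, face_succ hj]

lemma horiz_face_iff (hj : v ≤ j.castSucc.castSucc) : (π.face v).Horiz j ↔ π.Horiz j.succ := by
  rw [Horiz, Horiz, face_castSucc hj, face_succ hj]

lemma diag_face_iff (hj : v ≤ j.castSucc.castSucc) : (π.face v).Diag j ↔ π.Diag j.succ := by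
  rw [Diag, Diag, face_castSucc hj, face_succ hj]

lemma bend_face_iff (hj : v ≤ j.castSucc.castSucc) : (π.face v).Bend j ↔ π.Bend j.succ := by
  obtain _ | n := n
  · exact j.elim0
  refine and_congr (vert_face_iff hj) ⟨fun ⟨i, hi, hh⟩ => ⟨i.succ, by simp [hi], ?_⟩,
    fun ⟨i, hi, hh⟩ => ?_⟩
  · refine (horiz_face_iff (hj.trans ?_)).1 hh
    simp only [Fin.le_def, Fin.val_castSucc]
    omega
  · obtain ⟨i, rfl⟩ := Fin.exists_succ_eq.2 (Fin.ne_of_val_ne (by simp [hi]) : i ≠ 0)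
    refine ⟨i, by simpa using hi, (horiz_face_iff (hj.trans ?_)).2 hh⟩
    simp only [Fin.val_succ] at hi
    simp only [Fin.le_def, Fin.val_castSucc]
    omega

lemma noEventAfter_face_iff (hj : v ≤ j.succ.castSucc) :
    (π.face v).NoEventAfter j ↔ π.NoEventAfter j.succ := by
  have hle {i : Fin n} (hi : j < i) : v ≤ i.castSucc.castSucc :=
    hj.trans (Fin.castSucc_le_castSucc_iff.2 (Fin.succ_le_castSucc_iff.2 hi))
  refine ⟨fun h i hi => ?_, fun h i hi => ?_⟩
  · obtain ⟨i, rfl⟩ := Fin.exists_succ_eq.2 (Fin.ne_zero_of_lt hi)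
    rw [Fin.succ_lt_succ_iff] at hi
    rw [← diag_face_iff (hle hi), ← bend_face_iff (hle hi)]
    exact h i hi
  · rw [diag_face_iff (hle hi), bend_face_iff (hle hi)]
    exact h i.succ (Fin.succ_lt_succ_iff.2 hi)

lemma Bend.apply_eq {k : Fin n} (hk : π.Bend k.castSucc) :
    π k.castSucc.succ =
      ((π.face k.castSucc.succ k.castSucc).1, (π.face k.castSucc.succ k.succ).2) := by
  obtain ⟨hv, hh⟩ := bend_castSucc_iff.1 hk
  refine Prod.ext ?_ ?_
  · rw [face_apply, Fin.succAbove_succ_self]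
    exact hv.1.symm
  · change (π k.succ.castSucc).2 = (π (k.succ.castSucc.succAbove k.succ)).2
    rw [Fin.succAbove_castSucc_self]
    exact hh.2

lemma Bend.strictMono_of_face {k : Fin n} (hk : π.Bend k.castSucc)
    (hface : StrictMono (π.face k.castSucc.succ)) : StrictMono π := by
  obtain ⟨hv, hh⟩ := bend_castSucc_iff.1 hk
  refine Fin.strictMono_iff_lt_succ.2 fun i => ?_
  by_cases hi : i = k.castSucc
  · exact hi ▸ Prod.mk_lt_mk.2 (Or.inr ⟨hv.1.le, hv.2⟩)
  by_cases hi' : i = k.succ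
  · exact hi' ▸ Prod.mk_lt_mk.2 (Or.inl ⟨hh.1, hh.2.le⟩)
  obtain ⟨a, ha⟩ := Fin.exists_succAbove_eq (x := i.castSucc) (y := k.castSucc.succ)
    fun h => hi' (Fin.castSucc_injective _ h)
  obtain ⟨b, hb⟩ := Fin.exists_succAbove_eq (x := i.succ) (y := k.castSucc.succ)
    fun h => hi (Fin.succ_injective _ h)
  rw [← ha, ← hb]
  refine hface ((Fin.succAboveOrderEmb k.castSucc.succ).lt_iff_lt.1 ?_)
  exact (ha.trans_lt Fin.castSucc_lt_succ).trans_eq hb.symm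

lemma Bend.isInterior_face_iff {k : Fin n} (hk : π.Bend k.castSucc) :
    (π.face k.castSucc.succ).IsInterior ↔ π.IsInterior := by
  refine ⟨fun h => ⟨hk.strictMono_of_face h.1,
    h.2.1.of_comp (f := fun i => (π i).1), h.2.2.of_comp (f := fun i => (π i).2)⟩, fun h =>
    ⟨h.1.comp (Fin.succAboveOrderEmb _).strictMono, fun a => ?_, fun b => ?_⟩⟩
  · obtain ⟨i, rfl⟩ := h.2.1 a
    obtain rfl | ⟨i, rfl⟩ := Fin.eq_self_or_eq_succAbove k.castSucc.succ i
    exacts [⟨k.castSucc, by simp [hk.apply_eq]⟩, ⟨i, rfl⟩]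
  · obtain ⟨i, rfl⟩ := h.2.2 b
    obtain rfl | ⟨i, rfl⟩ := Fin.eq_self_or_eq_succAbove k.castSucc.succ i
    exacts [⟨k.succ, by simp [hk.apply_eq]⟩, ⟨i, rfl⟩]

end Face

section Pairing

variable {n p q : ℕ}

/-- The path where the `k`-th step, from `(a, b)` to `(a', b')`, is replaced by the two steps
`(a, b)`, `(a, b')`, `(a', b')`: if the step is diagonal this creates a bend. -/
def insertBend (π : LPath n p q) (k : Fin n) : LPath (n + 1) p q :=
  ((OrderHom.fst.comp π).comp (Fin.predAboveOrderHom k.castSucc)).prod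
    ((OrderHom.snd.comp π).comp (Fin.predAboveOrderHom k.succ))

lemma insertBend_apply (π : LPath n p q) (k : Fin n) (i : Fin (n + 2)) :
    π.insertBend k i = ((π (k.castSucc.predAbove i)).1, (π (k.succ.predAbove i)).2) := rfl

lemma predAbove_succ_succAbove (k : Fin n) (i : Fin (n + 1)) :
    k.castSucc.predAbove (k.castSucc.succ.succAbove i) = i :=
  Fin.succAbove_right_injective (p := k.castSucc.succ)
    (Fin.succ_succAbove_predAbove (Fin.succAbove_ne _ _))

lemma face_insertBend (π : LPath n p q) (k : Fin n) :
    (π.insertBend k).face k.castSucc.succ = π := by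
  refine OrderHom.ext _ _ (funext fun i => ?_)
  rw [face_apply, insertBend_apply, predAbove_succ_succAbove, Fin.succ_castSucc,
    Fin.predAbove_succAbove]

lemma Bend.insertBend_face {π : LPath (n + 1) p q} {k : Fin n} (hk : π.Bend k.castSucc) :
    (π.face k.castSucc.succ).insertBend k = π := by
  refine OrderHom.ext _ _ (funext fun i => ?_)
  rw [insertBend_apply]
  by_cases hi : i = k.castSucc.succ
  · rw [hi, Fin.predAbove_succ_self, hk.apply_eq, Fin.succ_castSucc, Fin.predAbove_castSucc_self]
  · rw [face_apply, face_apply, Fin.succ_succAbove_predAbove hi, Fin.succ_castSucc,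
      Fin.succAbove_predAbove hi]

lemma diag_face {π : LPath (n + 1) p q} {k : Fin n} (hk : π.Bend k.castSucc) :
    (π.face k.castSucc.succ).Diag k := by
  obtain ⟨hv, hh⟩ := bend_castSucc_iff.1 hk
  rw [Diag, face_apply, face_apply, Fin.succAbove_succ_self, Fin.succ_castSucc,
    Fin.succAbove_castSucc_self]
  exact ⟨hv.1.trans_lt hh.1, hv.2.trans_eq hh.2⟩

lemma Diag.bend_insertBend {π : LPath n p q} {k : Fin n} (hk : π.Diag k) :
    (π.insertBend k).Bend k.castSucc := by
  have hleft : π.insertBend k k.castSucc.castSucc = π k.castSucc := by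
    rw [insertBend_apply, Fin.predAbove_castSucc_self,
      Fin.predAbove_castSucc_of_le _ _ (Fin.castSucc_le_succ _)]
  have hmid : π.insertBend k k.castSucc.succ = ((π k.castSucc).1, (π k.succ).2) := by
    rw [insertBend_apply, Fin.predAbove_succ_self, Fin.succ_castSucc, Fin.predAbove_castSucc_self]
  have hright : π.insertBend k k.succ.succ = π k.succ := by
    rw [insertBend_apply, Fin.predAbove_succ_self,
      Fin.predAbove_succ_of_le _ _ (Fin.castSucc_le_succ _)]
  refine bend_castSucc_iff.2 ⟨?_, ?_⟩
  · rw [Vert, hleft, hmid]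
    exact ⟨rfl, hk.2⟩
  · rw [Horiz, ← Fin.succ_castSucc, hmid, hright]
    exact ⟨hk.1, rfl⟩

lemma Bend.noEventAfter_face_iff {π : LPath (n + 1) p q} {k : Fin n} (hk : π.Bend k.castSucc) :
    (π.face k.castSucc.succ).NoEventAfter k ↔ π.NoEventAfter k.castSucc := by
  rw [LPath.noEventAfter_face_iff (Fin.succ_castSucc k).le]
  refine ⟨fun h i hi => ?_, fun h i hi => h i (Fin.castSucc_lt_succ.trans hi)⟩
  have hhoriz := (bend_castSucc_iff.1 hk).2
  rcases (Fin.castSucc_lt_iff_succ_le.1 hi).eq_or_lt with rfl | hlt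
  exacts [⟨hhoriz.not_diag, fun hb => hb.1.not_horiz hhoriz⟩, h i hlt]

lemma paired_iff_face {π : LPath n p q} {π' : LPath (n + 1) p q} :
    π.Paired π' ↔ ∃ k : Fin n, π'.Bend k.castSucc ∧ π'.NoEventAfter k.castSucc ∧
      π = π'.face k.castSucc.succ := by
  refine ⟨fun ⟨i, hi, hlast, hface⟩ => ?_, fun ⟨k, hk, hlast, hface⟩ =>
    ⟨k.castSucc, hk, hlast, fun j => hface ▸ rfl⟩⟩
  obtain ⟨k, rfl⟩ := hi.exists_eq_castSucc
  exact ⟨k, hi, hlast, OrderHom.ext _ _ (funext hface)⟩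

lemma paired_iff_insertBend {π : LPath n p q} {π' : LPath (n + 1) p q} :
    π.Paired π' ↔ ∃ k : Fin n, π.Diag k ∧ π.NoEventAfter k ∧ π' = π.insertBend k := by
  rw [paired_iff_face]
  refine exists_congr fun k => ⟨?_, ?_⟩
  · rintro ⟨hk, hlast, rfl⟩
    exact ⟨diag_face hk, hk.noEventAfter_face_iff.2 hlast, hk.insertBend_face.symm⟩
  · rintro ⟨hk, hlast, rfl⟩
    refine ⟨hk.bend_insertBend, ?_, (face_insertBend π k).symm⟩
    rwa [← hk.bend_insertBend.noEventAfter_face_iff, face_insertBend]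

lemma Paired.isInterior_iff {π : LPath n p q} {π' : LPath (n + 1) p q} (h : π.Paired π') :
    π.IsInterior ↔ π'.IsInterior := by
  obtain ⟨k, hk, -, rfl⟩ := paired_iff_face.1 h
  exact hk.isInterior_face_iff

lemma Paired.left_unique {π₁ π₂ : LPath n p q} {π' : LPath (n + 1) p q} (h₁ : π₁.Paired π')
    (h₂ : π₂.Paired π') : π₁ = π₂ := by
  obtain ⟨k, hk, hk', rfl⟩ := paired_iff_face.1 h₁
  obtain ⟨l, hl, hl', rfl⟩ := paired_iff_face.1 h₂
  rw [Fin.castSucc_injective _ (eq_of_noEventAfter (Or.inr hk) (Or.inr hl) hk' hl')]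

lemma Paired.right_unique {π : LPath n p q} {π'₁ π'₂ : LPath (n + 1) p q} (h₁ : π.Paired π'₁)
    (h₂ : π.Paired π'₂) : π'₁ = π'₂ := by
  obtain ⟨k, hk, hk', rfl⟩ := paired_iff_insertBend.1 h₁
  obtain ⟨l, hl, hl', rfl⟩ := paired_iff_insertBend.1 h₂
  rw [eq_of_noEventAfter (Or.inl hk) (Or.inl hl) hk' hl']

lemma exists_paired_right_iff {π : LPath n p q} :
    (∃ π' : LPath (n + 1) p q, π.Paired π') ↔ π.EndsWithDiag := by
  simp only [paired_iff_insertBend]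
  exact ⟨fun ⟨_, k, hk, hlast, _⟩ => ⟨k, hk, hlast⟩, fun ⟨k, hk, hlast⟩ => ⟨_, k, hk, hlast, rfl⟩⟩

lemma exists_paired_left_iff {π' : LPath (n + 1) p q} :
    (∃ π : LPath n p q, π.Paired π') ↔ π'.EndsWithBend := by
  simp only [paired_iff_face]
  refine ⟨fun ⟨_, k, hk, hlast, _⟩ => ⟨_, hk, hlast⟩, fun ⟨i, hi, hlast⟩ => ?_⟩
  obtain ⟨k, rfl⟩ := hi.exists_eq_castSucc
  exact ⟨_, k, hi, hlast, rfl⟩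

end Pairing

section Weight

variable {n p q : ℕ}

lemma exists_eq_castSucc_succ {a w b : Fin (n + 2)} (haw : a < w) (hwb : w < b) :
    ∃ k : Fin n, w = k.castSucc.succ := by
  rw [Fin.lt_def] at haw hwb
  refine ⟨⟨w - 1, by omega⟩, Fin.ext ?_⟩
  change (w : ℕ) = w - 1 + 1
  omega

/-- If removing the vertex `w` preserves the surjectivity of both projections, then `w` shares its
abscissa with some other vertex, its ordinate with another one, and lies between these two. -/
lemma exists_corner_of_isInterior_face {π : LPath (n + 1) p q} (hπ : StrictMono π)
    {w : Fin (n + 2)} (hw : (π.face w).IsInterior) :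
    ∃ k : Fin n, w = k.castSucc.succ ∧
      (π.Bend k.castSucc ∨ π.Horiz k.castSucc ∧ π.Vert k.succ) := by
  obtain ⟨a, haw, ha⟩ : ∃ a, a ≠ w ∧ (π a).1 = (π w).1 :=
    (hw.2.1 (π w).1).imp' _ fun _ h => ⟨Fin.succAbove_ne _ _, h⟩
  obtain ⟨b, hbw, hb⟩ : ∃ b, b ≠ w ∧ (π b).2 = (π w).2 :=
    (hw.2.2 (π w).2).imp' _ fun _ h => ⟨Fin.succAbove_ne _ _, h⟩
  have hfst {c : Fin (n + 2)} (hc : c ∈ Set.uIcc a w) : (π c).1 = (π w).1 := by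
    simpa [ha] using (OrderHom.fst.comp π).monotone.mapsTo_uIcc hc
  have hsnd {c : Fin (n + 2)} (hc : c ∈ Set.uIcc b w) : (π c).2 = (π w).2 := by
    simpa [hb] using (OrderHom.snd.comp π).monotone.mapsTo_uIcc hc
  have hsep {c : Fin (n + 2)} (hca : c ∈ Set.uIcc a w) (hcb : c ∈ Set.uIcc b w) : c = w :=
    hπ.injective (Prod.ext (hfst hca) (hsnd hcb))
  rcases haw.lt_or_gt with haw | hwa <;> rcases hbw.lt_or_gt with hbw | hwb
  · have hmax := max_lt haw hbw
    exact absurd (hsep (Set.Icc_subset_uIcc ⟨le_max_left a b, hmax.le⟩)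
      (Set.Icc_subset_uIcc ⟨le_max_right a b, hmax.le⟩)) hmax.ne
  · obtain ⟨k, rfl⟩ := exists_eq_castSucc_succ haw hwb
    refine ⟨k, rfl, Or.inl (bend_castSucc_iff.2 ⟨vert_of_fst_eq hπ ?_, horiz_of_snd_eq hπ ?_⟩)⟩
    · exact hfst (Set.Icc_subset_uIcc ⟨Fin.le_castSucc_iff.2 haw, Fin.castSucc_le_succ _⟩)
    · exact (hsnd (Set.Icc_subset_uIcc' ⟨Fin.castSucc_le_succ k.succ,
        Fin.castSucc_lt_iff_succ_le (i := k.succ).1 hwb⟩)).symm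
  · obtain ⟨k, rfl⟩ := exists_eq_castSucc_succ hbw hwa
    refine ⟨k, rfl, Or.inr ⟨horiz_of_snd_eq hπ ?_, vert_of_fst_eq hπ ?_⟩⟩
    · exact hsnd (Set.Icc_subset_uIcc ⟨Fin.le_castSucc_iff.2 hbw, Fin.castSucc_le_succ _⟩)
    · exact (hfst (Set.Icc_subset_uIcc' ⟨Fin.castSucc_le_succ k.succ,
        Fin.castSucc_lt_iff_succ_le (i := k.succ).1 hwa⟩)).symm
  · have hmin := lt_min hwa hwb
    exact absurd (hsep (Set.Icc_subset_uIcc' ⟨hmin.le, min_le_left a b⟩)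
      (Set.Icc_subset_uIcc' ⟨hmin.le, min_le_right a b⟩)) hmin.ne'

/-- A height on the lattice `[0..p] × [0..q]`, which increases to the right and downwards. -/
def height (a : Fin (p + 1) × Fin (q + 1)) : ℕ := a.1 + a.2.rev

/-- The sum of the heights of the vertices of a path, which decreases along the vector field. -/
def weight (π : LPath n p q) : ℕ := ∑ i, height (π i)

lemma IsInterior.weight_le {π : LPath n p q} (hπ : π.IsInterior) :
    π.weight ≤ (n + 1) * (n + n) := by
  refine (Finset.sum_le_card_nsmul _ _ (n + n) fun i _ => ?_).trans_eq (by simp)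
  exact Nat.add_le_add ((π i).1.is_le.trans hπ.le_left) ((π i).2.rev.is_le.trans hπ.le_right)

lemma weight_face_add_height (π : LPath (n + 1) p q) (v : Fin (n + 2)) :
    (π.face v).weight + height (π v) = π.weight := by
  rw [weight, weight, Fin.sum_univ_succAbove _ v, add_comm]
  rfl

lemma height_lt_of_le_of_gt {a b : Fin (p + 1) × Fin (q + 1)} (hfst : a.1 ≤ b.1)
    (hsnd : b.2 < a.2) : height a < height b :=
  Nat.add_lt_add_of_le_of_lt hfst (Fin.rev_lt_rev.2 hsnd)

lemma height_lt_of_lt_of_ge {a b : Fin (p + 1) × Fin (q + 1)} (hfst : a.1 < b.1)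
    (hsnd : b.2 ≤ a.2) : height a < height b :=
  Nat.add_lt_add_of_lt_of_le hfst (Fin.rev_le_rev.2 hsnd)

lemma endsWithBend_face {π : LPath (n + 1) p q} {k : Fin n} (hk : π.Bend k.castSucc)
    (hlast : π.NoEventAfter k.castSucc) {w : Fin (n + 2)} (hw : w < k.castSucc.castSucc) :
    (π.face w).EndsWithBend := by
  obtain ⟨j, hj⟩ := Fin.exists_succ_eq.2
    fun h : k.castSucc = 0 => (Fin.zero_le w).not_gt (by simp [h] at hw)
  rw [← hj] at hk hlast hw
  rw [← Fin.succ_castSucc] at hw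
  have hwj : w ≤ j.castSucc.castSucc := Fin.le_castSucc_iff.2 hw
  exact ⟨j, (bend_face_iff hwj).2 hk, (noEventAfter_face_iff hw.le).2 hlast⟩

lemma height_lt_of_endsWithDiag_face {π : LPath (n + 1) p q} (hπ : StrictMono π) {k : Fin n}
    (hk : π.Bend k.castSucc) (hlast : π.NoEventAfter k.castSucc) {w : Fin (n + 2)}
    (hwk : w ≠ k.castSucc.succ) (hw : (π.face w).IsInterior) (hdiag : (π.face w).EndsWithDiag) :
    height (π k.castSucc.succ) < height (π w) := by
  obtain ⟨l, rfl, hcorner⟩ := exists_corner_of_isInterior_face hπ hw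
  rcases lt_trichotomy l k with hlk | rfl | hkl
  · rcases (Fin.le_def.2 (Nat.succ_le_of_lt hlk) :
      l.castSucc.succ ≤ k.castSucc.castSucc).eq_or_lt with heq | hlt
    · rw [heq]
      exact height_lt_of_le_of_gt hk.1.1.ge hk.1.2
    · exact absurd (endsWithBend_face hk hlast hlt) hdiag.not_endsWithBend
  · exact absurd rfl hwk
  · have hhoriz := (hcorner.resolve_left (hlast l.castSucc (by simpa using hkl)).2).1
    have hsnd := snd_eq_of_horiz hπ (a := k.castSucc.succ)
      (fun i hi => hlast i (Fin.succ_le_castSucc_iff.1 hi))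
      (Fin.succ_le_castSucc_iff.2 (Fin.castSucc_lt_castSucc_iff.2 hkl)) hhoriz
    have hlt := hπ (Fin.succ_lt_succ_iff.2 (Fin.castSucc_lt_castSucc_iff.2 hkl))
    refine height_lt_of_lt_of_ge (hlt.le.1.lt_of_ne fun hfst => ?_) hsnd.le
    exact hlt.ne (Prod.ext hfst hsnd.symm)

lemma weight_face_lt_weight_face {π : LPath (n + 1) p q} (hπ : StrictMono π) {k : Fin n}
    (hk : π.Bend k.castSucc) (hlast : π.NoEventAfter k.castSucc) {w : Fin (n + 2)}
    (hwk : w ≠ k.castSucc.succ) (hw : (π.face w).IsInterior) (hdiag : (π.face w).EndsWithDiag) :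
    (π.face w).weight < (π.face k.castSucc.succ).weight := by
  have hheight := height_lt_of_endsWithDiag_face hπ hk hlast hwk hw hdiag
  have hsum := (π.weight_face_add_height w).trans (π.weight_face_add_height k.castSucc.succ).symm
  omega

end Weight

section Map

variable {n p q p' q' : ℕ}

/-- The image of a path by the product of two monotone maps. -/
def map (s : Fin (p + 1) →o Fin (p' + 1)) (t : Fin (q + 1) →o Fin (q' + 1)) (π : LPath n p q) :
    LPath n p' q' :=
  (s.prodMap t).comp π

variable {s : Fin (p + 1) →o Fin (p' + 1)} {t : Fin (q + 1) →o Fin (q' + 1)} {π : LPath n p q}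
  {i : Fin n}

lemma strictMono_of_map (hmap : StrictMono (π.map s t)) : StrictMono π :=
  π.monotone.strictMono_of_injective (hmap.injective.of_comp (f := s.prodMap t))

lemma IsInterior.map (hπ : π.IsInterior) (hs : Function.Surjective s)
    (ht : Function.Surjective t) (hmap : StrictMono (π.map s t)) : (π.map s t).IsInterior :=
  ⟨hmap, hs.comp hπ.2.1, ht.comp hπ.2.2⟩

lemma Diag.of_map (h : (π.map s t).Diag i) : π.Diag i :=
  ⟨s.monotone.reflect_lt h.1, t.monotone.reflect_lt h.2⟩

lemma Vert.map (h : π.Vert i) (hmap : StrictMono (π.map s t)) : (π.map s t).Vert i :=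
  vert_of_fst_eq hmap (congrArg s h.1)

lemma Horiz.map (h : π.Horiz i) (hmap : StrictMono (π.map s t)) : (π.map s t).Horiz i :=
  horiz_of_snd_eq hmap (congrArg t h.2)

lemma Bend.map (h : π.Bend i) (hmap : StrictMono (π.map s t)) : (π.map s t).Bend i :=
  ⟨h.1.map hmap, h.2.imp fun _ hj => ⟨hj.1, hj.2.map hmap⟩⟩

lemma Bend.of_map (h : (π.map s t).Bend i) (hmap : StrictMono (π.map s t))
    (hdiag : ∀ j, i ≤ j → ¬ π.Diag j) : π.Bend i := by
  obtain ⟨hvert, j, hj, hhoriz⟩ := h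
  have hij : i ≤ j := Fin.le_def.2 (by omega)
  have hπ := strictMono_of_map hmap
  refine ⟨(vert_or_horiz_or_diag hπ i).resolve_right (not_or.2 ⟨fun hh => ?_, hdiag i le_rfl⟩),
    j, hj, ((vert_or_horiz_or_diag hπ j).resolve_left fun hv => ?_).resolve_right (hdiag j hij)⟩
  exacts [hvert.not_horiz (hh.map hmap), (hv.map hmap).not_horiz hhoriz]

lemma NoEventAfter.map (h : π.NoEventAfter i) (hmap : StrictMono (π.map s t)) :
    (π.map s t).NoEventAfter i := fun j hij =>
  ⟨fun hd => (h j hij).1 hd.of_map, fun hb =>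
    (h j hij).2 (hb.of_map hmap fun l hjl => (h l (hij.trans_le hjl)).1)⟩

lemma IsEventFree.map (h : π.IsEventFree) (hmap : StrictMono (π.map s t)) :
    (π.map s t).IsEventFree := fun i =>
  ⟨fun hd => (h i).1 hd.of_map, fun hb => (h i).2 (hb.of_map hmap fun j _ => (h j).1)⟩

lemma Paired.map {π' : LPath (n + 1) p q} (h : π.Paired π') (hmap : StrictMono (π'.map s t)) :
    (π.map s t).Paired (π'.map s t) := by
  obtain ⟨i, hi, hlast, hface⟩ := h
  exact ⟨i, hi.map hmap, hlast.map hmap, fun j => congrArg (s.prodMap t) (hface j)⟩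

end Map
end LPath

/-! ## Simplices of a prism -/

section Prism

variable {X Y : SSet.{u}} {n p q p' q' : ℕ}

lemma le_of_map_eq_map {σ : X _⦋p⦌} {σ' : X.nonDegenerate p'} {α : ⦋n⦌ ⟶ ⦋p⦌} {α' : ⦋n⦌ ⟶ ⦋p'⦌}
    [Epi α'] (h : X.map α.op σ = X.map α'.op σ'.1) : p' ≤ p := by
  obtain ⟨⟨s⟩⟩ := isSplitEpi_of_epi α'
  have hσ' : X.map (s.section_ ≫ α).op σ = σ'.1 := by
    rw [op_comp, Functor.map_comp, comp_apply, h, ← comp_apply, ← Functor.map_comp, ← op_comp,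
      s.id, op_id, CategoryTheory.Functor.map_id, id_apply]
  have := X.mono_of_nonDegenerate σ' _ _ hσ'
  exact SimplexCategory.le_of_mono (s.section_ ≫ α)

lemma exists_eq_comp_of_map_eq {σ : X.nonDegenerate p} {α : ⦋n⦌ ⟶ ⦋p⦌} [Epi α] {m : ℕ}
    {θ : ⦋n⦌ ⟶ ⦋m⦌} [Epi θ] {z : X _⦋m⦌} (hz : X.map θ.op z = X.map α.op σ.1) :
    ∃ β : ⦋m⦌ ⟶ ⦋p⦌, α = θ ≫ β := by
  obtain ⟨r, β, _, y, rfl⟩ := X.exists_nonDegenerate z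
  have hy : X.map α.op σ.1 = X.map (θ ≫ β).op y.1 := by
    rw [← hz, op_comp, Functor.map_comp, comp_apply]
  obtain rfl := X.unique_nonDegenerate_dim _ α σ rfl (θ ≫ β) y hy
  exact ⟨β, X.unique_nonDegenerate_map _ α σ rfl (θ ≫ β) y hy⟩

lemma map_prismSimplex {m : ℕ} (σ : X _⦋p⦌) (τ : Y _⦋q⦌) (π : LPath n p q)
    (θ : ⦋m⦌ ⟶ ⦋n⦌) :
    (X ⊗ Y).map θ.op (prismSimplex σ τ π) = prismSimplex σ τ (π.comp θ.toOrderHom) := by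
  refine Prod.ext ?_ ?_
  · exact (ConcreteCategory.congr_hom
      (X.map_comp (SimplexCategory.mkHom (OrderHom.fst.comp π)).op θ.op) σ).symm
  · exact (ConcreteCategory.congr_hom
      (Y.map_comp (SimplexCategory.mkHom (OrderHom.snd.comp π)).op θ.op) τ).symm

lemma prismSimplex_prod {σ : X _⦋p⦌} {τ : Y _⦋q⦌} (α : ⦋n⦌ ⟶ ⦋p⦌) (β : ⦋n⦌ ⟶ ⦋q⦌) :
    prismSimplex σ τ (α.toOrderHom.prod β.toOrderHom) = (X.map α.op σ, Y.map β.op τ) := by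
  have hα : SimplexCategory.mkHom (OrderHom.fst.comp (α.toOrderHom.prod β.toOrderHom)) = α := by
    ext; rfl
  have hβ : SimplexCategory.mkHom (OrderHom.snd.comp (α.toOrderHom.prod β.toOrderHom)) = β := by
    ext; rfl
  rw [prismSimplex, hα, hβ]

lemma δ_prismSimplex (σ : X _⦋p⦌) (τ : Y _⦋q⦌) (π : LPath (n + 1) p q) (v : Fin (n + 2)) :
    (X ⊗ Y).δ v (prismSimplex σ τ π) = prismSimplex σ τ (π.face v) :=
  map_prismSimplex σ τ π _

lemma prismSimplex_map (σ : X _⦋p'⦌) (τ : Y _⦋q'⦌) (α : ⦋p⦌ ⟶ ⦋p'⦌) (β : ⦋q⦌ ⟶ ⦋q'⦌)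
    (π : LPath n p q) :
    prismSimplex (X.map α.op σ) (Y.map β.op τ) π =
      prismSimplex σ τ (π.map α.toOrderHom β.toOrderHom) := by
  refine Prod.ext ?_ ?_
  · exact (ConcreteCategory.congr_hom
      (X.map_comp α.op (SimplexCategory.mkHom (OrderHom.fst.comp π)).op) σ).symm
  · exact (ConcreteCategory.congr_hom
      (Y.map_comp β.op (SimplexCategory.mkHom (OrderHom.snd.comp π)).op) τ).symm

lemma strictMono_of_prismSimplex_mem {σ : X _⦋p⦌} {τ : Y _⦋q⦌} {π : LPath n p q}
    (h : prismSimplex σ τ π ∈ (X ⊗ Y).nonDegenerate n) : StrictMono π := by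
  obtain _ | n := n
  · exact fun a b hab => absurd hab (by omega)
  refine Fin.strictMono_iff_lt_succ.2 fun i => (π.monotone (Fin.castSucc_le_succ i)).lt_of_ne
    fun heq => h ?_
  have hπ : (π.face i.succ).comp (SimplexCategory.σ i).toOrderHom = π := by
    refine OrderHom.ext _ _ (funext fun k => ?_)
    change π (i.succ.succAbove (i.predAbove k)) = π k
    by_cases hk : k = i.succ
    · rw [hk, Fin.predAbove_succ_self, Fin.succAbove_succ_self, heq]
    · rw [Fin.succ_succAbove_predAbove hk]
  rw [← hπ, ← map_prismSimplex]
  exact SSet.σ_mem_degenerate _ _ _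

lemma prismSimplex_mem (σ : X.nonDegenerate p) (τ : Y.nonDegenerate q) {π : LPath n p q}
    (hπ : π.IsInterior) : prismSimplex σ.1 τ.1 π ∈ (X ⊗ Y).nonDegenerate n := by
  have : Epi (SimplexCategory.mkHom (OrderHom.fst.comp π)) :=
    SimplexCategory.epi_iff_surjective.2 hπ.2.1
  have : Epi (SimplexCategory.mkHom (OrderHom.snd.comp π)) :=
    SimplexCategory.epi_iff_surjective.2 hπ.2.2
  rw [SSet.mem_nonDegenerate_iff_notMem_degenerate, SSet.mem_degenerate_iff]
  rintro ⟨m, hm, θ, _, z, hz⟩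
  obtain ⟨β, hβ⟩ := exists_eq_comp_of_map_eq (congrArg Prod.fst hz)
  obtain ⟨γ, hγ⟩ := exists_eq_comp_of_map_eq (congrArg Prod.snd hz)
  have hfac : (β.toOrderHom.prod γ.toOrderHom).comp θ.toOrderHom = π :=
    OrderHom.ext _ _ (funext fun i =>
      Prod.ext (SimplexCategory.congr_toOrderHom_apply hβ i).symm
        (SimplexCategory.congr_toOrderHom_apply hγ i).symm)
  rw [← hfac] at hπ
  have hcard := Fintype.card_le_of_injective _
    (Function.Injective.of_comp (f := β.toOrderHom.prod γ.toOrderHom) hπ.1.injective)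
  simp only [SimplexCategory.len_mk, Fintype.card_fin] at hcard
  omega

/-- A prism `σ × τ` of `X × Y`, where `σ` and `τ` are non-degenerate simplices. -/
structure Prism (X Y : SSet.{u}) where
  fstDim : ℕ
  sndDim : ℕ
  fst : X.nonDegenerate fstDim
  snd : Y.nonDegenerate sndDim

namespace Prism

/-- The dimension of the prism `σ × τ`. -/
def dim (P : Prism X Y) : ℕ := P.fstDim + P.sndDim

/-- The simplex of the prism `P` coded by a path. -/
abbrev simplex (P : Prism X Y) (π : LPath n P.fstDim P.sndDim) : (X ⊗ Y) _⦋n⦌ :=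
  prismSimplex P.fst.1 P.snd.1 π

lemma eq_or_dim_lt_of_simplex_eq {P P' : Prism X Y} {π : LPath n P.fstDim P.sndDim}
    {π' : LPath n P'.fstDim P'.sndDim} (hπ' : π'.IsInterior) (h : P.simplex π = P'.simplex π') :
    (⟨P, π⟩ : Σ P : Prism X Y, LPath n P.fstDim P.sndDim) = ⟨P', π'⟩ ∨ P'.dim < P.dim := by
  obtain ⟨p, q, σ, τ⟩ := P
  obtain ⟨p', q', σ', τ'⟩ := P'
  have : Epi (SimplexCategory.mkHom (OrderHom.fst.comp π')) :=
    SimplexCategory.epi_iff_surjective.2 hπ'.2.1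
  have : Epi (SimplexCategory.mkHom (OrderHom.snd.comp π')) :=
    SimplexCategory.epi_iff_surjective.2 hπ'.2.2
  have hfst := congrArg Prod.fst h
  have hsnd := congrArg Prod.snd h
  rcases (le_of_map_eq_map hfst).lt_or_eq with hp | rfl
  · exact Or.inr (add_lt_add_of_lt_of_le hp (le_of_map_eq_map hsnd))
  rcases (le_of_map_eq_map hsnd).lt_or_eq with hq | rfl
  · exact Or.inr (add_lt_add_of_le_of_lt le_rfl hq)
  obtain rfl := X.unique_nonDegenerate_simplex _ _ σ' hfst _ σ rfl
  obtain rfl := Y.unique_nonDegenerate_simplex _ _ τ' hsnd _ τ rfl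
  have hα := X.unique_nonDegenerate_map _ _ σ' hfst _ σ' rfl
  have hβ := Y.unique_nonDegenerate_map _ _ τ' hsnd _ τ' rfl
  obtain rfl : π = π' := OrderHom.ext _ _ (funext fun i =>
    Prod.ext (SimplexCategory.congr_toOrderHom_apply hα i).symm
      (SimplexCategory.congr_toOrderHom_apply hβ i).symm)
  exact Or.inl rfl

lemma simplex_inj {P P' : Prism X Y} {π : LPath n P.fstDim P.sndDim}
    {π' : LPath n P'.fstDim P'.sndDim} (hπ : π.IsInterior) (hπ' : π'.IsInterior)
    (h : P.simplex π = P'.simplex π') :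
    (⟨P, π⟩ : Σ P : Prism X Y, LPath n P.fstDim P.sndDim) = ⟨P', π'⟩ :=
  (eq_or_dim_lt_of_simplex_eq hπ' h).elim id fun hlt =>
    (eq_or_dim_lt_of_simplex_eq hπ h.symm).elim Eq.symm fun hgt => absurd hlt hgt.not_gt

/-- The code of a non-degenerate simplex of `X × Y` by a prism and an interior path. -/
noncomputable def codeEquiv (X Y : SSet.{u}) (n : ℕ) :
    (Σ P : Prism X Y, {π : LPath n P.fstDim P.sndDim // π.IsInterior}) ≃
      (X ⊗ Y).nonDegenerate n :=
  Equiv.ofBijective (fun c => ⟨c.1.simplex c.2.1, prismSimplex_mem _ _ c.2.2⟩) <| by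
    refine ⟨?_, fun ρ => ?_⟩
    · rintro ⟨P, π, hπ⟩ ⟨P', π', hπ'⟩ h
      cases simplex_inj hπ hπ' (congrArg Subtype.val h)
      rfl
    · obtain ⟨p, α, hα, σ, hσ⟩ := X.exists_nonDegenerate ρ.1.1
      obtain ⟨q, β, hβ, τ, hτ⟩ := Y.exists_nonDegenerate ρ.1.2
      rw [SimplexCategory.epi_iff_surjective] at hα hβ
      have hρ : prismSimplex σ.1 τ.1 (α.toOrderHom.prod β.toOrderHom) = ρ.1 :=
        (prismSimplex_prod α β).trans (Prod.ext hσ.symm hτ.symm)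
      exact ⟨⟨⟨p, q, σ, τ⟩, _, strictMono_of_prismSimplex_mem (hρ ▸ ρ.2), hα, hβ⟩,
        Subtype.ext hρ⟩

lemma exists_eq_simplex (ρ : (X ⊗ Y).nonDegenerate n) :
    ∃ (P : Prism X Y) (π : LPath n P.fstDim P.sndDim), π.IsInterior ∧ ρ.1 = P.simplex π := by
  obtain ⟨⟨P, π, hπ⟩, rfl⟩ := (codeEquiv X Y n).surjective ρ
  exact ⟨P, π, hπ, rfl⟩

end Prism
end Prism

/-! ## The Eilenberg-Zilber vector field is admissible -/

section Cell

variable {X : SSet.{u}} {n : ℕ}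

lemma cell_of_mem {x : X _⦋n⦌} (hx : x ∈ X.nonDegenerate n) :
    cell X x = Finsupp.single ⟨x, hx⟩ 1 := dif_pos hx

open scoped Classical in
lemma cell_apply (x : X _⦋n⦌) (y : X.nonDegenerate n) :
    cell X x y = if x = y.1 then 1 else 0 := by
  by_cases hx : x ∈ X.nonDegenerate n
  · simp only [cell_of_mem hx, Finsupp.single_apply, Subtype.ext_iff]
  · rw [cell_of_degenerate X x (by rwa [SSet.mem_degenerate_iff_notMem_nonDegenerate]),
      if_neg (by rintro rfl; exact hx y.2), Finsupp.zero_apply]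

lemma incidence_normalized (ρ : X.nonDegenerate n) (ρ' : X.nonDegenerate (n + 1)) :
    (normalized X).incidence ρ ρ' =
      ∑ i : Fin (n + 2), (-1 : ℤ) ^ (i : ℕ) * cell X (X.δ i ρ'.1) ρ := by
  have h : (normalized X).incidence ρ ρ' = normD X n (Finsupp.single ρ' 1) ρ := rfl
  rw [h, ← cell_of_mem ρ'.2, normD_cell, Finsupp.finsetSum_apply]
  rfl

lemma exists_δ_eq_of_incidence_ne_zero {ρ : X.nonDegenerate n} {ρ' : X.nonDegenerate (n + 1)}
    (h : (normalized X).incidence ρ ρ' ≠ 0) : ∃ i, X.δ i ρ'.1 = ρ.1 := by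
  by_contra! hne
  refine h ?_
  rw [incidence_normalized]
  exact Finset.sum_eq_zero fun i _ => by rw [cell_apply, if_neg (hne i), mul_zero]

lemma incidence_eq_of_δ_eq {ρ : X.nonDegenerate n} {ρ' : X.nonDegenerate (n + 1)} {i : Fin (n + 2)}
    (hi : ∀ j, X.δ j ρ'.1 = ρ.1 ↔ j = i) : (normalized X).incidence ρ ρ' = (-1) ^ (i : ℕ) := by
  classical
  simp only [incidence_normalized, cell_apply, hi, mul_ite, mul_one, mul_zero,
    Finset.sum_ite_eq', Finset.mem_univ, if_true]

end Cell

section Field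

variable {X Y : SSet.{u}} {n : ℕ} {P : Prism X Y}

lemma ezField_iff {ρ : (X ⊗ Y).nonDegenerate n} {ρ' : (X ⊗ Y).nonDegenerate (n + 1)} :
    ezField X Y n ρ ρ' ↔ ∃ (P : Prism X Y) (π : LPath n P.fstDim P.sndDim)
      (π' : LPath (n + 1) P.fstDim P.sndDim),
      π'.IsInterior ∧ π.Paired π' ∧ ρ.1 = P.simplex π ∧ ρ'.1 = P.simplex π' :=
  ⟨fun ⟨p, q, σ, τ, π, π', _, hπ', h⟩ => ⟨⟨p, q, σ, τ⟩, π, π', hπ', h⟩,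
    fun ⟨P, π, π', hπ', h⟩ =>
      ⟨_, _, P.fst, P.snd, π, π', h.1.isInterior_iff.2 hπ', hπ', h⟩⟩

lemma ezField_left_iff {ρ : (X ⊗ Y).nonDegenerate n} {π : LPath n P.fstDim P.sndDim}
    (hπ : π.IsInterior) (hρ : ρ.1 = P.simplex π) {ρ' : (X ⊗ Y).nonDegenerate (n + 1)} :
    ezField X Y n ρ ρ' ↔ ∃ π', π.Paired π' ∧ ρ'.1 = P.simplex π' := by
  rw [ezField_iff]
  refine ⟨fun ⟨P₁, π₁, π', hπ', hpair, h, h'⟩ => ?_, fun ⟨π', hpair, h'⟩ =>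
    ⟨P, π, π', hpair.isInterior_iff.1 hπ, hpair, hρ, h'⟩⟩
  cases Prism.simplex_inj (hpair.isInterior_iff.2 hπ') hπ (h.symm.trans hρ)
  exact ⟨π', hpair, h'⟩

lemma ezField_right_iff {ρ' : (X ⊗ Y).nonDegenerate (n + 1)}
    {π' : LPath (n + 1) P.fstDim P.sndDim} (hπ' : π'.IsInterior) (hρ' : ρ'.1 = P.simplex π')
    {ρ : (X ⊗ Y).nonDegenerate n} :
    ezField X Y n ρ ρ' ↔ ∃ π, π.Paired π' ∧ ρ.1 = P.simplex π := by
  rw [ezField_iff]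
  refine ⟨fun ⟨P₁, π, π'₁, hπ'₁, hpair, h, h'⟩ => ?_, fun ⟨π, hpair, h⟩ =>
    ⟨P, π, π', hπ', hpair, h, hρ'⟩⟩
  cases Prism.simplex_inj hπ'₁ hπ' (h'.symm.trans hρ')
  exact ⟨π, hpair, h⟩

section

variable {ρ : (X ⊗ Y).nonDegenerate n} {π : LPath n P.fstDim P.sndDim} (hπ : π.IsInterior)
  (hρ : ρ.1 = P.simplex π)
include hπ hρ

lemma isSource_ezField_iff : CellComplex.IsSource (ezField X Y) ρ ↔ π.EndsWithDiag := by
  rw [CellComplex.IsSource, ← LPath.exists_paired_right_iff]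
  simp only [ezField_left_iff hπ hρ]
  exact ⟨fun ⟨_, π', hpair, _⟩ => ⟨π', hpair⟩, fun ⟨π', hpair⟩ =>
    ⟨⟨_, prismSimplex_mem _ _ (hpair.isInterior_iff.1 hπ)⟩, π', hpair, rfl⟩⟩

lemma isTarget_ezField_iff : CellComplex.IsTarget (ezField X Y) ρ ↔ π.EndsWithBend := by
  obtain _ | n := n
  · exact ⟨fun h => h.elim, fun ⟨k, _⟩ => k.elim0⟩
  rw [CellComplex.IsTarget, ← LPath.exists_paired_left_iff]
  simp only [ezField_right_iff hπ hρ]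
  exact ⟨fun ⟨_, π₁, hpair, _⟩ => ⟨π₁, hpair⟩, fun ⟨π₁, hpair⟩ =>
    ⟨⟨_, prismSimplex_mem _ _ (hpair.isInterior_iff.2 hπ)⟩, π₁, hpair, rfl⟩⟩

lemma isCritical_ezField_iff : CellComplex.IsCritical (ezField X Y) ρ ↔ π.IsEventFree := by
  rw [CellComplex.IsCritical, isSource_ezField_iff hπ hρ, isTarget_ezField_iff hπ hρ,
    LPath.isEventFree_iff]

end

lemma isVectorField_ezField (X Y : SSet.{u}) : CellComplex.IsVectorField (ezField X Y) where
  regular n ρ ρ' h := by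
    obtain ⟨P, π, π', hπ', hpair, hρ, hρ'⟩ := ezField_iff.1 h
    have hπ := hpair.isInterior_iff.2 hπ'
    obtain ⟨k, -, -, rfl⟩ := LPath.paired_iff_face.1 hpair
    have hface (j : Fin (n + 2)) : (X ⊗ Y).δ j ρ'.1 = ρ.1 ↔ j = k.castSucc.succ := by
      rw [hρ, hρ', δ_prismSimplex]
      refine ⟨fun hj => LPath.face_injective hπ'.1.injective ?_, fun hj => hj ▸ rfl⟩
      obtain heq | hlt := Prism.eq_or_dim_lt_of_simplex_eq hπ hj
      · exact eq_of_heq (Sigma.mk.inj heq).2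
      · exact absurd hlt (lt_irrefl _)
    rw [incidence_eq_of_δ_eq hface, abs_neg_one_pow]
  target_unique n ρ ρ₁ ρ₂ h₁ h₂ := by
    obtain ⟨P, π, π', hπ', hpair, hρ, hρ'⟩ := ezField_iff.1 h₁
    obtain ⟨π'₂, hpair₂, hρ₂⟩ := (ezField_left_iff (hpair.isInterior_iff.2 hπ') hρ).1 h₂
    exact Subtype.ext (by rw [hρ', hρ₂, hpair.right_unique hpair₂])
  source_unique n ρ₁ ρ₂ ρ' h₁ h₂ := by
    obtain ⟨P, π, π', hπ', hpair, hρ, hρ'⟩ := ezField_iff.1 h₁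
    obtain ⟨π₂, hpair₂, hρ₂⟩ := (ezField_right_iff hπ' hρ').1 h₂
    exact Subtype.ext (by rw [hρ, hρ₂, hpair.left_unique hpair₂])
  disjoint n ρ := by
    obtain ⟨P, π, hπ, hρ⟩ := Prism.exists_eq_simplex ρ
    rw [isSource_ezField_iff hπ hρ, isTarget_ezField_iff hπ hρ]
    exact fun h => h.1.not_endsWithBend h.2

/-- The rank of a non-degenerate simplex of `X × Y`: the lexicographic order on the dimension of
its prism and the weight of its path, encoded by a natural number. -/
noncomputable def ezRank (X Y : SSet.{u}) (n : ℕ) (ρ : (X ⊗ Y).nonDegenerate n) : ℕ :=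
  let c := (Prism.codeEquiv X Y n).symm ρ
  c.1.dim * ((n + 1) * (n + n) + 1) + c.2.1.weight

lemma ezRank_eq {ρ : (X ⊗ Y).nonDegenerate n} {π : LPath n P.fstDim P.sndDim}
    (hπ : π.IsInterior) (hρ : ρ.1 = P.simplex π) :
    ezRank X Y n ρ = P.dim * ((n + 1) * (n + n) + 1) + π.weight := by
  have hcode : (Prism.codeEquiv X Y n).symm ρ = ⟨P, π, hπ⟩ :=
    (Prism.codeEquiv X Y n).symm_apply_eq.2 (Subtype.ext hρ)
  rw [ezRank, hcode]

lemma isRank_ezRank (X Y : SSet.{u}) : CellComplex.IsRank (ezField X Y) (ezRank X Y) := by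
  intro n ρ ρ₂ ρ' hvec hsource hinc hne
  obtain ⟨P, π, π', hπ', hpair, hρ, hρ'⟩ := ezField_iff.1 hvec
  obtain ⟨v, hv⟩ := exists_δ_eq_of_incidence_ne_zero hinc
  obtain ⟨P₂, π₂, hπ₂, hρ₂⟩ := Prism.exists_eq_simplex ρ₂
  have hdiag := (isSource_ezField_iff hπ₂ hρ₂).1 hsource
  rw [hρ', δ_prismSimplex, hρ₂] at hv
  have hπ := hpair.isInterior_iff.2 hπ'
  rw [ezRank_eq hπ₂ hρ₂, ezRank_eq hπ hρ]
  obtain heq | hlt := Prism.eq_or_dim_lt_of_simplex_eq hπ₂ hv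
  · cases heq
    obtain ⟨k, hk, hlast, rfl⟩ := LPath.paired_iff_face.1 hpair
    have hvk : v ≠ k.castSucc.succ := by
      rintro rfl
      exact hne (Subtype.ext (hρ₂.trans hρ.symm))
    exact Nat.add_lt_add_left
      (LPath.weight_face_lt_weight_face hπ'.1 hk hlast hvk hπ₂ hdiag) _
  · have hweight := hπ₂.weight_le
    have hdim := Nat.mul_le_mul_right ((n + 1) * (n + n) + 1) (Nat.succ_le_of_lt hlt)
    rw [Nat.succ_mul] at hdim
    omega

lemma isAdmissible_ezField (X Y : SSet.{u}) : CellComplex.IsAdmissible (ezField X Y) :=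
  (isRank_ezRank X Y).isAdmissible

end Field

/-! ## Functoriality -/

section Functoriality

variable {X Y X' Y' X'' Y'' : SSet.{u}} {n p q : ℕ}

lemma normMap_cell (φ : X ⟶ X') (x : X _⦋n⦌) : normMap φ n (cell X x) = cell X' (φ.app _ x) := by
  by_cases hx : x ∈ X.nonDegenerate n
  · rw [cell_of_mem hx, normMap, Finsupp.linearCombination_single, one_smul]
  · rw [← SSet.mem_degenerate_iff_notMem_nonDegenerate] at hx
    rw [cell_of_degenerate X x hx, map_zero,
      cell_of_degenerate X' _ (SSet.degenerate_app_apply hx φ)]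

lemma nChains_hom_ext {M : Type*} [AddCommMonoid M] [Module ℤ M] {f g : NChains X n →ₗ[ℤ] M}
    (h : ∀ x : X.nonDegenerate n, f (cell X x.1) = g (cell X x.1)) : f = g :=
  Finsupp.lhom_ext' fun x => LinearMap.ext_ring (by simpa only [cell_of_mem x.2] using! h x)

lemma normMap_normD (φ : X ⟶ X') (n : ℕ) :
    normMap φ n ∘ₗ normD X n = normD X' n ∘ₗ normMap φ (n + 1) := by
  refine nChains_hom_ext fun x => ?_
  simp only [LinearMap.comp_apply, normD_cell, normMap_cell, map_sum, map_zsmul]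
  exact Finset.sum_congr rfl fun i _ => congrArg (fun y => (-1 : ℤ) ^ (i : ℕ) • cell X' y)
    (NatTrans.naturality_apply φ (SimplexCategory.δ i).op x.1)

lemma normMap_id (X : SSet.{u}) (n : ℕ) : normMap (𝟙 X) n = LinearMap.id :=
  nChains_hom_ext fun x => by rw [normMap_cell, LinearMap.id_apply]; rfl

lemma normMap_comp (φ : X ⟶ X') (φ' : X' ⟶ X'') (n : ℕ) :
    normMap (φ ≫ φ') n = normMap φ' n ∘ₗ normMap φ n :=
  nChains_hom_ext fun x => by
    rw [LinearMap.comp_apply, normMap_cell, normMap_cell, normMap_cell]; rfl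

lemma normMap_id_tensorHom_id (X Y : SSet.{u}) (n : ℕ) :
    normMap (𝟙 X ⊗ₘ 𝟙 Y) n = LinearMap.id := by
  rw [id_tensorHom_id, normMap_id]

lemma normMap_comp_tensorHom_comp (φ : X ⟶ X') (ψ : Y ⟶ Y') (φ' : X' ⟶ X'') (ψ' : Y' ⟶ Y'')
    (n : ℕ) :
    normMap ((φ ≫ φ') ⊗ₘ (ψ ≫ ψ')) n = normMap (φ' ⊗ₘ ψ') n ∘ₗ normMap (φ ⊗ₘ ψ) n := by
  rw [← tensorHom_comp_tensorHom, normMap_comp]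

lemma tensMap_apply (φ : X ⟶ X') (ψ : Y ⟶ Y') (z : Tens X Y n)
    (pq : {pq : ℕ × ℕ // pq.1 + pq.2 = n}) :
    tensMap φ ψ n z pq = TensorProduct.map (normMap φ pq.1.1) (normMap ψ pq.1.2) (z pq) := rfl

lemma tensMap_id (X Y : SSet.{u}) (n : ℕ) : tensMap (𝟙 X) (𝟙 Y) n = LinearMap.id :=
  LinearMap.ext fun z => DFinsupp.ext fun pq => by
    rw [tensMap_apply, normMap_id, normMap_id, TensorProduct.map_id]
    rfl

lemma tensMap_comp (φ : X ⟶ X') (ψ : Y ⟶ Y') (φ' : X' ⟶ X'') (ψ' : Y' ⟶ Y'') (n : ℕ) :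
    tensMap (φ ≫ φ') (ψ ≫ ψ') n = tensMap φ' ψ' n ∘ₗ tensMap φ ψ n :=
  LinearMap.ext fun z => DFinsupp.ext fun pq => by
    rw [LinearMap.comp_apply, tensMap_apply, tensMap_apply, tensMap_apply, normMap_comp,
      normMap_comp, TensorProduct.map_comp]
    rfl

lemma tensorHom_prismSimplex (φ : X ⟶ X') (ψ : Y ⟶ Y') (σ : X _⦋p⦌) (τ : Y _⦋q⦌)
    (π : LPath n p q) :
    (φ ⊗ₘ ψ).app _ (prismSimplex σ τ π) = prismSimplex (φ.app _ σ) (ψ.app _ τ) π :=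
  (SSet.tensorHom_app_apply φ ψ _).trans (Prod.ext
    (NatTrans.naturality_apply φ (SimplexCategory.mkHom (OrderHom.fst.comp π)).op σ)
    (NatTrans.naturality_apply ψ (SimplexCategory.mkHom (OrderHom.snd.comp π)).op τ))

lemma Prism.exists_tensorHom_simplex_eq (φ : X ⟶ X') (ψ : Y ⟶ Y') (P : Prism X Y) :
    ∃ (P' : Prism X' Y') (s : Fin (P.fstDim + 1) →o Fin (P'.fstDim + 1))
      (t : Fin (P.sndDim + 1) →o Fin (P'.sndDim + 1)),
      Function.Surjective s ∧ Function.Surjective t ∧ ∀ (n : ℕ) (π : LPath n P.fstDim P.sndDim),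
        (φ ⊗ₘ ψ).app _ (P.simplex π) = P'.simplex (π.map s t) := by
  obtain ⟨p, α, hα, σ, hσ⟩ := X'.exists_nonDegenerate (φ.app _ P.fst.1)
  obtain ⟨q, β, hβ, τ, hτ⟩ := Y'.exists_nonDegenerate (ψ.app _ P.snd.1)
  rw [SimplexCategory.epi_iff_surjective] at hα hβ
  refine ⟨⟨p, q, σ, τ⟩, α.toOrderHom, β.toOrderHom, hα, hβ, fun n π => ?_⟩
  rw [tensorHom_prismSimplex, hσ, hτ]
  exact prismSimplex_map σ.1 τ.1 α β π

lemma isFieldCompatible (φ : X ⟶ X') (ψ : Y ⟶ Y') : IsFieldCompatible φ ψ where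
  vector n ρ ρ' h hmem := by
    obtain ⟨P, π, π', hπ', hpair, hρ, hρ'⟩ := ezField_iff.1 h
    obtain ⟨P₁, s, t, hs, ht, himage⟩ := P.exists_tensorHom_simplex_eq φ ψ
    have himage_ρ := hρ ▸ himage n π
    have himage_ρ' := hρ' ▸ himage (n + 1) π'
    have hmap := strictMono_of_prismSimplex_mem (himage_ρ' ▸ hmem)
    have hpair_map := hpair.map hmap
    have hπ'_map := hπ'.map hs ht hmap
    exact ⟨himage_ρ ▸ prismSimplex_mem _ _ (hpair_map.isInterior_iff.2 hπ'_map),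
      ezField_iff.2 ⟨P₁, _, _, hπ'_map, hpair_map, himage_ρ, himage_ρ'⟩⟩
  critical n ρ hcrit hmem := by
    obtain ⟨P, π, hπ, hρ⟩ := Prism.exists_eq_simplex ρ
    obtain ⟨P₁, s, t, hs, ht, himage⟩ := P.exists_tensorHom_simplex_eq φ ψ
    have himage_ρ := hρ ▸ himage n π
    have hmap := strictMono_of_prismSimplex_mem (himage_ρ ▸ hmem)
    exact (isCritical_ezField_iff (hπ.map hs ht hmap) himage_ρ).2
      (((isCritical_ezField_iff hπ hρ).1 hcrit).map hmap)

lemma normMap_incl_mem_range {P : X.nonDegenerate n → Prop} {Q : X'.nonDegenerate n → Prop}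
    (φ : X ⟶ X') (h : ∀ x, P x → ∀ hx : φ.app _ x.1 ∈ X'.nonDegenerate n, Q ⟨_, hx⟩)
    (z : {x // P x} →₀ ℤ) : normMap φ n (incl P z) ∈ LinearMap.range (incl Q) := by
  induction z using Finsupp.induction_linear with
  | zero => simp only [map_zero, zero_mem]
  | add z w hz hw => simpa only [map_add] using add_mem hz hw
  | single x r =>
    rw [incl_single, ← mul_one r, ← smul_eq_mul, ← Finsupp.smul_single, ← cell_of_mem x.1.2,
      map_smul, normMap_cell]
    refine Submodule.smul_mem _ r ?_
    by_cases hx : φ.app _ x.1.1 ∈ X'.nonDegenerate n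
    · exact ⟨Finsupp.single ⟨_, h x.1 x.2 hx⟩ 1, by rw [incl_single, cell_of_mem hx]⟩
    · rw [← SSet.mem_degenerate_iff_notMem_nonDegenerate] at hx
      rw [cell_of_degenerate _ _ hx]
      exact zero_mem _

lemma isVectorFieldMap_normMap (φ : X ⟶ X') (ψ : Y ⟶ Y') :
    CellComplex.IsVectorFieldMap (ezField X Y) (ezField X' Y') (normMap (φ ⊗ₘ ψ)) where
  comm n := LinearMap.congr_fun (normMap_normD (φ ⊗ₘ ψ) n)
  target n := normMap_incl_mem_range _ fun x hx hx' => by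
    obtain _ | n := n
    · exact hx.elim
    · obtain ⟨ρ, hρ⟩ := hx
      obtain ⟨hmem, hvec⟩ := (isFieldCompatible φ ψ).vector n ρ x hρ hx'
      exact ⟨_, hvec⟩
  critical n := normMap_incl_mem_range _ ((isFieldCompatible φ ψ).critical n)

end Functoriality

/-! ## Critical chains and the tensor product -/

section Tensor

variable {X Y X' Y' : SSet.{u}} {n p q : ℕ}

/-- The cells of the tensor product of the normalized chain complexes: the pairs `σ ⊗ τ` of
non-degenerate simplices of total dimension `n`. -/
abbrev TensCells (X Y : SSet.{u}) (n : ℕ) : Type u :=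
  Σ pq : {pq : ℕ × ℕ // pq.1 + pq.2 = n}, X.nonDegenerate pq.1.1 × Y.nonDegenerate pq.1.2

/-- The last simplex of a prism, as a critical cell. -/
def lastCell (X Y : SSet.{u}) (n : ℕ) (c : TensCells X Y n) :
    {ρ : (X ⊗ Y).nonDegenerate n // CellComplex.IsCritical (ezField X Y) ρ} :=
  ⟨⟨_, prismSimplex_mem c.2.1 c.2.2 (LPath.isInterior_last c.1.2)⟩,
    (isCritical_ezField_iff (P := ⟨_, _, c.2.1, c.2.2⟩) (LPath.isInterior_last c.1.2) rfl).2
      (LPath.isEventFree_last c.1.2)⟩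

lemma lastCell_bijective (X Y : SSet.{u}) (n : ℕ) : Function.Bijective (lastCell X Y n) := by
  constructor
  · rintro ⟨⟨⟨p, q⟩, hpq⟩, σ, τ⟩ ⟨⟨⟨p', q'⟩, hpq'⟩, σ', τ'⟩ h
    have hprism : (⟨p, q, σ, τ⟩ : Prism X Y) = ⟨p', q', σ', τ'⟩ :=
      congrArg Sigma.fst (Prism.simplex_inj (LPath.isInterior_last hpq)
        (LPath.isInterior_last hpq') (congrArg (fun z => z.1.1) h))
    cases hprism
    rfl
  · rintro ⟨ρ, hcrit⟩
    obtain ⟨P, π, hπ, hρ⟩ := Prism.exists_eq_simplex ρ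
    have hfree := (isCritical_ezField_iff hπ hρ).1 hcrit
    have hpq := hπ.add_eq fun i => (hfree i).1
    obtain rfl := hπ.eq_last hfree hpq
    exact ⟨⟨⟨(P.fstDim, P.sndDim), hpq⟩, P.fst, P.snd⟩, Subtype.ext (Subtype.ext hρ.symm)⟩

lemma mem_nonDegenerate_of_prismSimplex_last_mem {x : X _⦋p⦌} {y : Y _⦋q⦌} (h : p + q = n)
    (hmem : prismSimplex x y (LPath.last h) ∈ (X ⊗ Y).nonDegenerate n) :
    x ∈ X.nonDegenerate p ∧ y ∈ Y.nonDegenerate q := by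
  obtain ⟨p', α, hα, x', rfl⟩ := X.exists_nonDegenerate x
  obtain ⟨q', β, hβ, y', rfl⟩ := Y.exists_nonDegenerate y
  rw [prismSimplex_map] at hmem
  have hint := (LPath.isInterior_last h).map (SimplexCategory.epi_iff_surjective.1 hα)
    (SimplexCategory.epi_iff_surjective.1 hβ) (strictMono_of_prismSimplex_mem hmem)
  have hsum : p' + q' = n := hint.add_eq fun i hi => (LPath.isEventFree_last h i).1 hi.of_map
  have hp : p' ≤ p := SimplexCategory.le_of_epi α
  have hq : q' ≤ q := SimplexCategory.le_of_epi β
  obtain rfl : p = p' := by omega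
  obtain rfl : q = q' := by omega
  rw [SimplexCategory.eq_id_of_epi α, SimplexCategory.eq_id_of_epi β]
  simp only [op_id, CategoryTheory.Functor.map_id, id_apply, Subtype.coe_prop, and_self]

/-- The element `x ⊗ y` of the tensor product. -/
noncomputable def tens (pq : {pq : ℕ × ℕ // pq.1 + pq.2 = n}) (x : X _⦋pq.1.1⦌)
    (y : Y _⦋pq.1.2⦌) : Tens X Y n :=
  DirectSum.lof ℤ _ (fun pq : {pq : ℕ × ℕ // pq.1 + pq.2 = n} =>
    NChains X pq.1.1 ⊗[ℤ] NChains Y pq.1.2) pq (cell X x ⊗ₜ cell Y y)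

lemma tens_hom_ext {M : Type*} [AddCommMonoid M] [Module ℤ M] {f g : Tens X Y n →ₗ[ℤ] M}
    (h : ∀ pq (x : X.nonDegenerate _) (y : Y.nonDegenerate _),
      f (tens pq x.1 y.1) = g (tens pq x.1 y.1)) : f = g :=
  DirectSum.linearMap_ext ℤ fun pq => TensorProduct.ext <|
    nChains_hom_ext fun x => nChains_hom_ext fun y => h pq x y

lemma tensMap_tens (φ : X ⟶ X') (ψ : Y ⟶ Y') (pq : {pq : ℕ × ℕ // pq.1 + pq.2 = n})
    (x : X _⦋pq.1.1⦌) (y : Y _⦋pq.1.2⦌) :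
    tensMap φ ψ n (tens pq x y) = tens pq (φ.app _ x) (ψ.app _ y) := by
  rw [tens, tens, ← normMap_cell, ← normMap_cell]
  exact DirectSum.lmap_lof (R := ℤ) _ _ _

lemma critOfTens_tens (pq : {pq : ℕ × ℕ // pq.1 + pq.2 = n}) (x : X _⦋pq.1.1⦌)
    (y : Y _⦋pq.1.2⦌) :
    critOfTens X Y n (tens pq x y) = proj (CellComplex.IsCritical (ezField X Y))
      (cell (X ⊗ Y) (prismSimplex x y (LPath.last pq.2))) := by
  rw [critOfTens, tens, DirectSum.toModule_lof]
  change Finsupp.linearCombination ℤ _ (finsuppTensorFinsupp' ℤ _ _ (cell X x ⊗ₜ cell Y y)) = _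
  by_cases hxy : x ∈ X.nonDegenerate _ ∧ y ∈ Y.nonDegenerate _
  · rw [cell_of_mem hxy.1, cell_of_mem hxy.2, finsuppTensorFinsupp'_single_tmul_single, mul_one,
      Finsupp.linearCombination_single, one_smul]
  · have hprism : prismSimplex x y (LPath.last pq.2) ∈ (X ⊗ Y).degenerate n := by
      rw [SSet.mem_degenerate_iff_notMem_nonDegenerate]
      exact fun hmem => hxy (mem_nonDegenerate_of_prismSimplex_last_mem pq.2 hmem)
    rw [not_and_or, ← SSet.mem_degenerate_iff_notMem_nonDegenerate,
      ← SSet.mem_degenerate_iff_notMem_nonDegenerate] at hxy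
    have htens : cell X x ⊗ₜ[ℤ] cell Y y = 0 := by
      rcases hxy with hx | hy
      · rw [cell_of_degenerate X x hx, TensorProduct.zero_tmul]
      · rw [cell_of_degenerate Y y hy, TensorProduct.tmul_zero]
    rw [htens, cell_of_degenerate _ _ hprism, map_zero, map_zero, map_zero]

/-- The linear equivalence exhibiting the tensor product as the free group on its cells. -/
noncomputable def tensEquiv (X Y : SSet.{u}) (n : ℕ) : Tens X Y n ≃ₗ[ℤ] (TensCells X Y n →₀ ℤ) :=
  (DFinsupp.mapRange.linearEquiv fun _ => finsuppTensorFinsupp' ℤ _ _).trans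
    (sigmaFinsuppLequivDFinsupp ℤ).symm

lemma tensEquiv_tens (pq : {pq : ℕ × ℕ // pq.1 + pq.2 = n}) (x : X.nonDegenerate pq.1.1)
    (y : Y.nonDegenerate pq.1.2) :
    tensEquiv X Y n (tens pq x.1 y.1) = Finsupp.single ⟨pq, x, y⟩ 1 := by
  have hcell : finsuppTensorFinsupp' ℤ _ _ (cell X x.1 ⊗ₜ[ℤ] cell Y y.1) =
      Finsupp.single (x, y) 1 := by
    rw [cell_of_mem x.2, cell_of_mem y.2, finsuppTensorFinsupp'_single_tmul_single, mul_one]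
  refine (sigmaFinsuppLequivDFinsupp ℤ).symm_apply_eq.2
    (Eq.trans ?_ (sigmaFinsuppEquivDFinsupp_single _ _).symm)
  exact (DFinsupp.mapRange_single (hf := fun _ => map_zero _)).trans (congrArg _ hcell)

lemma critOfTens_tens_coe (pq : {pq : ℕ × ℕ // pq.1 + pq.2 = n}) (x : X.nonDegenerate pq.1.1)
    (y : Y.nonDegenerate pq.1.2) :
    critOfTens X Y n (tens pq x.1 y.1) = Finsupp.single (lastCell X Y n ⟨pq, x, y⟩) 1 := by
  rw [critOfTens_tens]
  exact (congrArg _ (cell_of_mem (lastCell X Y n ⟨pq, x, y⟩).1.2)).trans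
    (proj_single_of_pos (lastCell X Y n ⟨pq, x, y⟩).2 1)

lemma critOfTens_eq (X Y : SSet.{u}) (n : ℕ) :
    critOfTens X Y n =
      Finsupp.lmapDomain ℤ ℤ (lastCell X Y n) ∘ₗ (tensEquiv X Y n).toLinearMap := by
  refine tens_hom_ext fun pq x y => ?_
  rw [critOfTens_tens_coe, LinearMap.comp_apply, LinearEquiv.coe_coe, tensEquiv_tens,
    Finsupp.lmapDomain_apply, Finsupp.mapDomain_single]

lemma critOfTens_bijective (X Y : SSet.{u}) (n : ℕ) : Function.Bijective (critOfTens X Y n) := by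
  have hlast := lastCell_bijective X Y n
  have hmap : Function.Bijective (Finsupp.lmapDomain ℤ ℤ (lastCell X Y n)) :=
    ⟨Finsupp.mapDomain_injective hlast.1, Finsupp.mapDomain_surjective hlast.2⟩
  rw [critOfTens_eq]
  exact hmap.comp (tensEquiv X Y n).bijective

lemma critOfTens_comp_tensMap (φ : X ⟶ X') (ψ : Y ⟶ Y') (n : ℕ) :
    critOfTens X' Y' n ∘ₗ tensMap φ ψ n =
      (proj (CellComplex.IsCritical (ezField X' Y')) ∘ₗ normMap (φ ⊗ₘ ψ) n ∘ₗ
        incl (CellComplex.IsCritical (ezField X Y))) ∘ₗ critOfTens X Y n := by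
  refine tens_hom_ext fun pq x y => ?_
  simp only [LinearMap.comp_apply]
  rw [tensMap_tens, critOfTens_tens, critOfTens_tens_coe, incl_single,
    ← cell_of_mem (lastCell X Y n ⟨pq, x, y⟩).1.2, normMap_cell, ← tensorHom_prismSimplex]
  rfl

lemma bijective_dTargetSource_ezField (X Y : SSet.{u}) (n : ℕ) :
    Function.Bijective (CellComplex.dTargetSource (ezField X Y) n) :=
  (isAdmissible_ezField X Y).bijective_dTargetSource (isVectorField_ezField X Y) n

theorem isReduction_ez (X Y : SSet.{u}) :
    IsReduction (normD (X ⊗ Y)) (ezD X Y) (ezF X Y) (ezG X Y) (ezH X Y) :=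
  (CellComplex.isReduction_w (isVectorField_ezField X Y)
    (bijective_dTargetSource_ezField X Y)).transport (critOfTens_bijective X Y)

theorem isReductionMorphism_ez (φ : X ⟶ X') (ψ : Y ⟶ Y') :
    IsReductionMorphism
      (normD (X ⊗ Y)) (ezD X Y) (ezF X Y) (ezG X Y) (ezH X Y)
      (normD (X' ⊗ Y')) (ezD X' Y') (ezF X' Y') (ezG X' Y') (ezH X' Y')
      (normMap (φ ⊗ₘ ψ)) (tensMap φ ψ) :=
  ((isVectorFieldMap_normMap φ ψ).isReductionMorphism
    (isVectorField_ezField X Y) (bijective_dTargetSource_ezField X Y)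
    (isVectorField_ezField X' Y') (bijective_dTargetSource_ezField X' Y')).transport
    (critOfTens_bijective X Y) (critOfTens_bijective X' Y')
    fun n => LinearMap.congr_fun (critOfTens_comp_tensMap φ ψ n)

end Tensor

end EZ

theorem mainTheorem10 :
    -- the Eilenberg-Zilber vector field is an admissible discrete vector field whose critical
    -- chains are identified with the tensor product, and `(f, g, h)` is a reduction
    (∀ X Y : SSet.{u},
      EZ.CellComplex.IsVectorField (EZ.ezField X Y) ∧
      EZ.CellComplex.IsAdmissible (EZ.ezField X Y) ∧
      (∀ n, Function.Bijective (EZ.critOfTens X Y n)) ∧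
      EZ.IsReduction (EZ.normD (X ⊗ Y)) (EZ.ezD X Y)
        (EZ.ezF X Y) (EZ.ezG X Y) (EZ.ezH X Y)) ∧
    -- simplicial maps induce a morphism of reductions, and are compatible with the vector fields
    (∀ (X Y X' Y' : SSet.{u}) (φ : X ⟶ X') (ψ : Y ⟶ Y'),
      EZ.IsReductionMorphism
        (EZ.normD (X ⊗ Y)) (EZ.ezD X Y) (EZ.ezF X Y) (EZ.ezG X Y) (EZ.ezH X Y)
        (EZ.normD (X' ⊗ Y')) (EZ.ezD X' Y') (EZ.ezF X' Y') (EZ.ezG X' Y') (EZ.ezH X' Y')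
        (EZ.normMap (φ ⊗ₘ ψ)) (EZ.tensMap φ ψ) ∧
      EZ.IsFieldCompatible φ ψ) ∧
    -- the induced morphism is natural: it respects identities and compositions
    (∀ (X Y : SSet.{u}) (n : ℕ),
      EZ.normMap (𝟙 X ⊗ₘ 𝟙 Y) n = LinearMap.id ∧
      EZ.tensMap (𝟙 X) (𝟙 Y) n = LinearMap.id) ∧
    (∀ (X Y X' Y' X'' Y'' : SSet.{u}) (φ : X ⟶ X') (ψ : Y ⟶ Y') (φ' : X' ⟶ X'') (ψ' : Y' ⟶ Y'')
      (n : ℕ),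
      EZ.normMap ((φ ≫ φ') ⊗ₘ (ψ ≫ ψ')) n =
        EZ.normMap (φ' ⊗ₘ ψ') n ∘ₗ EZ.normMap (φ ⊗ₘ ψ) n ∧
      EZ.tensMap (φ ≫ φ') (ψ ≫ ψ') n = EZ.tensMap φ' ψ' n ∘ₗ EZ.tensMap φ ψ n) :=
  ⟨fun X Y => ⟨EZ.isVectorField_ezField X Y, EZ.isAdmissible_ezField X Y,
      EZ.critOfTens_bijective X Y, EZ.isReduction_ez X Y⟩,
    fun _ _ _ _ φ ψ => ⟨EZ.isReductionMorphism_ez φ ψ, EZ.isFieldCompatible φ ψ⟩,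
    fun X Y n => ⟨EZ.normMap_id_tensorHom_id X Y n, EZ.tensMap_id X Y n⟩,
    fun _ _ _ _ _ _ φ ψ φ' ψ' n =>
      ⟨EZ.normMap_comp_tensorHom_comp φ ψ φ' ψ' n, EZ.tensMap_comp φ ψ φ' ψ' n⟩⟩
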